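/- **Setting.** Let $d\ge 1$ and $\langle x\rangle=(1+|x|^2)^{1/2}$ on $\mathbb{R}^d$. Let $\alpha,\beta>0$, let $w,k$ be real with $k\neq 0$, and let $\rho_{sr},\rho_{lr},\rho_{lr}'\in\,]0,1]$. Let $\kappa\in C_c^\infty(\mathbb{R};\mathbb{R})$ with $0\le\kappa\le 1$ and $\kappa=1$ on $[-1,1]$, and put $$W_{\alpha\beta}(x)=w\bigl(1-\kappa(|x|)\bigr)|x|^{-\beta}\sin(k|x|^\alpha).$$ Let $v\in C^1(\mathbb{R}^d;\mathbb{R}^d)$ have bounded derivative and satisfy $|v(x)|=O(\langle x\rangle^{\rho_{sr}})$ (for instance, $v$ bounded). Let $V_{sr},\tilde V_{sr},V_{lr},V_c:\mathbb{R}^d\to\mathbb{R}$ be measurable functions such that $\langle x\rangle^{1+\rho_{sr}}V_{sr}$, $\langle x\rangle^{1+\rho_{sr}}\tilde V_{sr}$, $\langle x\rangle^{\rho_{lr}}V_{lr}$ and the distributions $\langle x\rangle^{\rho_{sr}}\,v\cdot\nabla\tilde V_{sr}$ and $\langle x\rangle^{\rho_{lr}'}\,x\cdot\nabla V_{lr}$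 are bounded, such that $V_c$ is compactly supported, and such that the operator $V_c(Q)$ of multiplication by $V_c$ is $H_0$-compact, where $H_0=-\Delta$ is the self-adjoint operator in $L^2(\mathbb{R}^d)$ with domain the Sobolev space $\mathcal{H}^2(\mathbb{R}^d)$. Let $$V=V_{sr}+v\cdot\nabla\tilde V_{sr}+V_{lr}+V_c+W_{\alpha\beta},\qquad H=H_0+V(Q).$$ Let $A$ be the generator of dilations, that is, the self-adjoint realization of $(P\cdot Q+Q\cdot P)/2$ with $P=-i\nabla$, for which $(e^{itA}f)(x)=e^{td/2}f(e^tx)$. A bounded operator $T$ on $L^2(\mathbb{R}^d)$ is of class $C^1(A)$ if, for every $f\in L^2(\mathbb{R}^d)$, the map $t\mapsto e^{itA}Te^{-itA}f$ is continuously differentiable on $\mathbb{R}$; a self-adjoint operator $N$ is of class $C^1(A)$ if $(N-z)^{-1}$ is of class $C^1(A)$ for some $z$ outside the spectrum of $N$. **Proposition 3.2.** Assume $w\neq 0$ and $|\alpha-1|+\beta<1$. Then $H$ is not of class $C^1(A)$. Moreover, the commutator form $[W_{\alpha\beta}(Q),A]$ is not bounded from $\mathcal{H}^2$ to $\mathcal{H}^{-2}$: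 there is no constant $C$ such that $$\bigl|\langle W_{\alpha\beta}(Q)f,Ag\rangle-\langle Af,W_{\alpha\beta}(Q)g\rangle\bigr|\le C\,\|f\|_{\mathcal{H}^2}\|g\|_{\mathcal{H}^2}\quad\text{for all } f,g\in\mathcal{H}^2(\mathbb{R}^d)\cap\mathcal{D}(A).$$ -/

import Mathlib

open MeasureTheory
open scoped SchwartzMap ENNReal ContDiff Laplacian InnerProductSpace

noncomputable section

namespace OscSchrodinger

/-! ### Unbounded operators in a complex Hilbert space -/

section Abstract

variable {𝓗 : Type*} [NormedAddCommGroup 𝓗] [InnerProductSpace ℂ 𝓗]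

/-- `R` is the bounded resolvent `(N - z)⁻¹` of the (unbounded) operator `N`; thus `z` lies outside
the spectrum of `N` iff such an `R` exists. -/
def IsResolventAt (N : 𝓗 →ₗ.[ℂ] 𝓗) (z : ℂ) (R : 𝓗 →L[ℂ] 𝓗) : Prop :=
  (∀ f : 𝓗, ∃ u : N.domain, (u : 𝓗) = R f ∧ N u - z • (u : 𝓗) = f) ∧
    ∀ u : N.domain, R (N u - z • (u : 𝓗)) = u

/-- A bounded operator `T` is of class `C¹(M)`, where `U t = exp (i t M)`: for every vector `f`, the
map `t ↦ exp (i t M) T exp (-i t M) f` is continuously differentiable. -/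
def BoundedIsC1 (U : ℝ → 𝓗 →ₗᵢ[ℂ] 𝓗) (T : 𝓗 →L[ℂ] 𝓗) : Prop :=
  ∀ f : 𝓗, ContDiff ℝ 1 fun t : ℝ => U t (T (U (-t) f))

/-- An (unbounded) self-adjoint operator `N` is of class `C¹(M)`, where `U t = exp (i t M)`: for some
`z` outside the spectrum of `N`, the resolvent `(N - z)⁻¹` is of class `C¹(M)`. -/
def IsC1 (U : ℝ → 𝓗 →ₗᵢ[ℂ] 𝓗) (N : 𝓗 →ₗ.[ℂ] 𝓗) : Prop :=
  ∃ (z : ℂ) (R : 𝓗 →L[ℂ] 𝓗), IsResolventAt N z R ∧ BoundedIsC1 U R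

/-- The self-adjoint generator `M` of a unitary group `U t = exp (i t M)`: its domain consists of the
`f` such that `t ↦ U t f` is differentiable at `0`, and `M f = -i (d/dt) U t f` at `t = 0`. -/
def generator (U : ℝ → 𝓗 →ₗᵢ[ℂ] 𝓗) : 𝓗 →ₗ.[ℂ] 𝓗 where
  domain :=
    { carrier := {f | DifferentiableAt ℝ (fun t : ℝ => U t f) 0}
      zero_mem' := by simp
      add_mem' := by
        intro f g hf hg
        simp only [Set.mem_ofPred_eq, map_add] at *
        exact hf.add hg
      smul_mem' := by
        intro c f hf
        simp only [Set.mem_ofPred_eq, map_smul] at *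
        exact hf.const_smul c }
  toFun :=
    { toFun := fun f => (-Complex.I) • deriv (fun t : ℝ => U t (f : 𝓗)) 0
      map_add' := by
        intro f g
        have hf : DifferentiableAt ℝ (fun t : ℝ => U t (f : 𝓗)) 0 := f.2
        have hg : DifferentiableAt ℝ (fun t : ℝ => U t (g : 𝓗)) 0 := g.2
        simp only [Submodule.coe_add, map_add]
        rw [deriv_fun_add hf hg, smul_add]
      map_smul' := by
        intro c f
        have hf : DifferentiableAt ℝ (fun t : ℝ => U t (f : 𝓗)) 0 := f.2
        simp only [Submodule.coe_smul, map_smul, RingHom.id_apply]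
        rw [deriv_fun_const_smul c hf, smul_comm] }

/-- The commutator form `⟨f, [T, M] g⟩ = ⟨T f, M g⟩ - ⟨M f, T g⟩` on `D(T) ∩ D(M)`, for symmetric
operators `T` and `M`. -/
def commutatorForm (T M : 𝓗 →ₗ.[ℂ] 𝓗) (f g : ↥(T.domain ⊓ M.domain)) : ℂ :=
  ⟪T ⟨f, f.2.1⟩, M ⟨g, g.2.2⟩⟫_ℂ - ⟪M ⟨f, f.2.2⟩, T ⟨g, g.2.1⟩⟫_ℂ

/-- `T` is relatively compact with respect to `N` (`N`-compact): `D(N) ⊆ D(T)`, and for every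
sequence `u n` in `D(N)` such that `u n` and `N (u n)` are bounded, `T (u n)` has a convergent
subsequence. -/
def IsRelativelyCompact (T N : 𝓗 →ₗ.[ℂ] 𝓗) : Prop :=
  ∃ h : N.domain ≤ T.domain, ∀ u : ℕ → N.domain,
    (∃ C : ℝ, ∀ n, ‖(u n : 𝓗)‖ ≤ C ∧ ‖N (u n)‖ ≤ C) →
      ∃ (σ : ℕ → ℕ) (y : 𝓗), StrictMono σ ∧
        Filter.Tendsto (fun n => T ⟨u (σ n), h (u (σ n)).2⟩) Filter.atTop (nhds y)

end Abstract

/-! ### Operators in `L²(ℝᵈ)` -/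

/-- The Euclidean space `ℝᵈ`. -/
abbrev Eucl (d : ℕ) : Type := EuclideanSpace ℝ (Fin d)

/-- The Hilbert space `L²(ℝᵈ)` of complex functions. -/
abbrev L2 (d : ℕ) : Type := Lp ℂ 2 (volume : Measure (Eucl d))

/-- The Japanese bracket `⟨x⟩ = (1 + |x|²)^(1/2)`. -/
def bracket {d : ℕ} (x : Eucl d) : ℝ := Real.sqrt (1 + ‖x‖ ^ 2)

/-- The Sobolev space `H²(ℝᵈ)`, as a subspace of `L²(ℝᵈ)`. -/
def sobolevTwo (d : ℕ) : Submodule ℂ (L2 d) where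
  carrier := {u | TemperedDistribution.MemSobolev 2 2 (u : 𝓢'(Eucl d, ℂ))}
  zero_mem' := by
    simp [← Lp.toTemperedDistributionCLM_apply]
  add_mem' := by
    intro u v hu hv
    have h := TemperedDistribution.MemSobolev.add hu hv
    simpa [← Lp.toTemperedDistributionCLM_apply] using h
  smul_mem' := by
    intro c u hu
    have h := TemperedDistribution.MemSobolev.smul c hu
    simpa [← Lp.toTemperedDistributionCLM_apply] using h

theorem toTemperedDistribution_injective {d : ℕ} {f g : L2 d}
    (h : (f : 𝓢'(Eucl d, ℂ)) = (g : 𝓢'(Eucl d, ℂ))) : f = g := by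
  have hk := Lp.ker_toTemperedDistributionCLM_eq_bot (E := Eucl d) (F := ℂ) (μ := volume) (p := 2)
  exact LinearMap.ker_eq_bot.mp hk (by simpa [Lp.toTemperedDistributionCLM_apply] using h)

theorem exists_neg_laplacian {d : ℕ} (u : sobolevTwo d) :
    ∃ h : L2 d, (h : 𝓢'(Eucl d, ℂ)) = -Δ ((u : L2 d) : 𝓢'(Eucl d, ℂ)) := by
  have h1 := TemperedDistribution.MemSobolev.laplacian (s := 2) u.2
  rw [sub_self] at h1
  obtain ⟨f, hf⟩ := TemperedDistribution.memSobolev_zero_iff.mp h1.neg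
  exact ⟨f, hf.symm⟩

/-- The free operator `H₀ = -Δ` with domain `H²(ℝᵈ)`, with `Δ` in the sense of distributions. -/
def freeHamiltonian (d : ℕ) : L2 d →ₗ.[ℂ] L2 d where
  domain := sobolevTwo d
  toFun :=
    { toFun := fun u => (exists_neg_laplacian u).choose
      map_add' := by
        intro u v
        apply toTemperedDistribution_injective
        have hu := (exists_neg_laplacian u).choose_spec
        have hv := (exists_neg_laplacian v).choose_spec
        have huv := (exists_neg_laplacian (u + v)).choose_spec
        rw [huv]
        simp only [← Lp.toTemperedDistributionCLM_apply,
          ← TemperedDistribution.laplacianCLM_apply] at *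
        simp only [Submodule.coe_add, map_add, hu, hv]
        abel
      map_smul' := by
        intro c u
        apply toTemperedDistribution_injective
        have hu := (exists_neg_laplacian u).choose_spec
        have hcu := (exists_neg_laplacian (c • u)).choose_spec
        rw [hcu]
        simp only [← Lp.toTemperedDistributionCLM_apply,
          ← TemperedDistribution.laplacianCLM_apply] at *
        simp only [Submodule.coe_smul, map_smul, RingHom.id_apply, hu, smul_neg] }

/-- The norm of `H²(ℝᵈ)`: `‖⟨P⟩² u‖ = ‖u + H₀ u‖` in `L²(ℝᵈ)`. -/
def sobolevTwoNorm {d : ℕ} (u : sobolevTwo d) : ℝ := ‖(u : L2 d) + freeHamiltonian d u‖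

theorem ae_mul_add {d : ℕ} (c : Eucl d → ℂ) (u v : L2 d) :
    (fun x => c x * (u + v : L2 d) x) =ᵐ[volume] fun x => c x * u x + c x * v x := by
  filter_upwards [Lp.coeFn_add u v] with x hx
  rw [hx, Pi.add_apply, mul_add]

theorem ae_mul_smul {d : ℕ} (c : Eucl d → ℂ) (a : ℂ) (u : L2 d) :
    (fun x => c x * (a • u : L2 d) x) =ᵐ[volume] fun x => a • (c x * u x) := by
  filter_upwards [Lp.coeFn_smul a u] with x hx
  rw [hx, Pi.smul_apply, smul_eq_mul, smul_eq_mul, mul_left_comm]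

/-- The domain of the multiplication operator `V(Q)`: the `u` in `L²(ℝᵈ)` with `V u` in `L²(ℝᵈ)`. -/
def mulDomain {d : ℕ} (V : Eucl d → ℝ) : Submodule ℂ (L2 d) where
  carrier := {u | MemLp (fun x => (V x : ℂ) * u x) 2 volume}
  zero_mem' := by
    refine (MemLp.zero (ε := ℂ)).ae_eq ?_
    filter_upwards [Lp.coeFn_zero ℂ 2 (volume : Measure (Eucl d))] with x hx
    rw [hx, Pi.zero_apply, mul_zero]
  add_mem' := fun {u v} hu hv =>
    (MemLp.add hu hv).ae_eq (ae_mul_add (fun x => (V x : ℂ)) u v).symm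
  smul_mem' := fun a u hu =>
    (MemLp.const_smul hu a).ae_eq (ae_mul_smul (fun x => (V x : ℂ)) a u).symm

/-- The maximal operator `V(Q)` of multiplication by the real function `V` in `L²(ℝᵈ)`. -/
def mulOp {d : ℕ} (V : Eucl d → ℝ) : L2 d →ₗ.[ℂ] L2 d where
  domain := mulDomain V
  toFun :=
    { toFun := fun u => MemLp.toLp (fun x => (V x : ℂ) * (u : L2 d) x) u.2
      map_add' := fun u v =>
        (MemLp.toLp_congr (u + v).2 (MemLp.add u.2 v.2)
          (ae_mul_add (fun x => (V x : ℂ)) (u : L2 d) (v : L2 d))).trans (MemLp.toLp_add u.2 v.2)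
      map_smul' := fun a u =>
        (MemLp.toLp_congr (a • u).2 (MemLp.const_smul u.2 a)
          (ae_mul_smul (fun x => (V x : ℂ)) a (u : L2 d))).trans (MemLp.toLp_const_smul a u.2) }

/-- The Schrödinger operator `H = H₀ + V(Q)` on `D(H₀) ∩ D(V(Q))` (which is `D(H₀) = H²(ℝᵈ)` when
`V(Q)` is `H₀`-bounded). -/
def schrodinger {d : ℕ} (V : Eucl d → ℝ) : L2 d →ₗ.[ℂ] L2 d := freeHamiltonian d + mulOp V

/-! ### Dilations -/

theorem eLpNorm_dilate {d : ℕ} (t : ℝ) {f : Eucl d → ℂ} (hf : AEStronglyMeasurable f volume) :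
    AEStronglyMeasurable (fun x => (Real.exp (t * d / 2) : ℂ) * f (Real.exp t • x)) volume ∧
    eLpNorm (fun x => (Real.exp (t * d / 2) : ℂ) * f (Real.exp t • x)) 2 volume =
      eLpNorm f 2 volume := by
  have ht : Real.exp t ≠ 0 := (Real.exp_pos t).ne'
  have hmap := Measure.map_addHaar_smul (volume : Measure (Eucl d)) ht
  have hmeas : Measurable fun x : Eucl d => Real.exp t • x := by fun_prop
  have hf' : AEStronglyMeasurable f (Measure.map (fun x : Eucl d => Real.exp t • x) volume) := by
    rw [hmap]; exact hf.smul_measure _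
  refine ⟨(hf'.comp_measurable hmeas).const_mul _, ?_⟩
  have h1 : (fun x => (Real.exp (t * d / 2) : ℂ) * f (Real.exp t • x)) =
      (Real.exp (t * d / 2) : ℂ) • (f ∘ fun x : Eucl d => Real.exp t • x) := by
    ext x; simp
  rw [h1, eLpNorm_const_smul, ← eLpNorm_map_measure hf' hmeas.aemeasurable, hmap,
    eLpNorm_smul_measure_of_ne_top (by simp)]
  have hn : ‖(Real.exp (t * d / 2) : ℂ)‖ₑ = ENNReal.ofReal (Real.exp (t * d / 2)) := by
    rw [← ofReal_norm, Complex.norm_real, Real.norm_of_nonneg (Real.exp_pos _).le]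
  have hp : (0 : ℝ) < |(Real.exp t ^ Module.finrank ℝ (Eucl d))⁻¹| := by positivity
  rw [hn, ENNReal.ofReal_rpow_of_pos hp, smul_eq_mul, ← mul_assoc,
    ← ENNReal.ofReal_mul (Real.exp_pos _).le]
  have : Real.exp (t * d / 2) *
      |(Real.exp t ^ Module.finrank ℝ (Eucl d))⁻¹| ^ (1 / (2 : ℝ≥0∞)).toReal = 1 := by
    rw [abs_of_pos (by positivity), ← Real.exp_nat_mul, ← Real.exp_neg, ← Real.exp_mul,
      ← Real.exp_add]
    simp
    ring
  rw [this, ENNReal.ofReal_one, one_mul]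

theorem memLp_dilate {d : ℕ} (t : ℝ) (f : L2 d) :
    MemLp (fun x => (Real.exp (t * d / 2) : ℂ) * f (Real.exp t • x)) 2 volume := by
  have h := eLpNorm_dilate t (Lp.aestronglyMeasurable f)
  exact ⟨h.1, by rw [h.2]; exact Lp.eLpNorm_lt_top f⟩

theorem ae_dilate {d : ℕ} (t : ℝ) {p : Eucl d → Prop} (h : ∀ᵐ x, p x) :
    ∀ᵐ x : Eucl d, p (Real.exp t • x) := by
  have ht : Real.exp t ≠ 0 := (Real.exp_pos t).ne'
  have hq : Measure.QuasiMeasurePreserving (fun x : Eucl d => Real.exp t • x) volume volume := by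
    refine ⟨by fun_prop, ?_⟩
    rw [Measure.map_addHaar_smul (volume : Measure (Eucl d)) ht]
    exact Measure.smul_absolutelyContinuous
  exact hq.ae h

/-- The unitary dilation group `(exp (i t A) f) (x) = exp (t d / 2) f (exp (t) x)` on `L²(ℝᵈ)`. -/
def dilation (d : ℕ) (t : ℝ) : L2 d →ₗᵢ[ℂ] L2 d where
  toFun f := (memLp_dilate t f).toLp
  map_add' f g := by
    refine (MemLp.toLp_congr _ ((memLp_dilate t f).add (memLp_dilate t g)) ?_).trans
      (MemLp.toLp_add _ _)
    filter_upwards [ae_dilate t (Lp.coeFn_add f g)] with x hx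
    rw [hx, Pi.add_apply, Pi.add_apply, mul_add]
  map_smul' c f := by
    refine (MemLp.toLp_congr _ ((memLp_dilate t f).const_smul c) ?_).trans
      (MemLp.toLp_const_smul _ _)
    filter_upwards [ae_dilate t (Lp.coeFn_smul c f)] with x hx
    rw [hx, Pi.smul_apply, Pi.smul_apply, smul_eq_mul, smul_eq_mul, mul_left_comm]
  norm_map' f := by
    have h := eLpNorm_dilate t (Lp.aestronglyMeasurable f)
    simp only [LinearMap.coe_mk, AddHom.coe_mk]
    rw [Lp.norm_toLp, h.2, Lp.norm_def]

/-- The generator of dilations `A`, the self-adjoint realization of `(P·Q + Q·P)/2`. -/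
def dilationGenerator (d : ℕ) : L2 d →ₗ.[ℂ] L2 d := generator (dilation d)

/-- The commutator form `[T, A]` is bounded from `H²` to `H⁻²`:
`|⟨f, [T, A] g⟩| ≤ C ‖f‖ ‖g‖` with `H²`-norms, for all `f, g` in `H²` on which the form is defined. -/
def CommutatorBoundedOnSobolevTwo {d : ℕ} (T : L2 d →ₗ.[ℂ] L2 d) : Prop :=
  ∃ C : ℝ, ∀ (f g : L2 d) (hf : f ∈ T.domain ⊓ (dilationGenerator d).domain)
    (hg : g ∈ T.domain ⊓ (dilationGenerator d).domain)
    (hf₂ : f ∈ sobolevTwo d) (hg₂ : g ∈ sobolevTwo d),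
      ‖commutatorForm T (dilationGenerator d) ⟨f, hf⟩ ⟨g, hg⟩‖ ≤
        C * sobolevTwoNorm ⟨f, hf₂⟩ * sobolevTwoNorm ⟨g, hg₂⟩

/-! ### Potentials -/

/-- The oscillating potential `W(x) = w (1 - κ(|x|)) |x|^(-β) sin (k |x|^α)`. -/
def oscPotential {d : ℕ} (w k α β : ℝ) (κ : ℝ → ℝ) (x : Eucl d) : ℝ :=
  w * (1 - κ ‖x‖) * ‖x‖ ^ (-β) * Real.sin (k * ‖x‖ ^ α)

/-- `F` is a.e. measurable and `⟨x⟩^s F(x)` is (essentially) bounded on `ℝᵈ`. -/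
def WeightedBounded {d : ℕ} (s : ℝ) (F : Eucl d → ℝ) : Prop :=
  AEMeasurable F volume ∧ ∃ C : ℝ, ∀ᵐ x : Eucl d, |bracket x ^ s * F x| ≤ C

/-- The divergence of a vector field. -/
def divergence {d : ℕ} (b : Eucl d → Eucl d) (x : Eucl d) : ℝ :=
  ∑ i : Fin d, (fderiv ℝ b x (EuclideanSpace.single i 1)) i

/-- The distribution `b·∇F` is the function `U`, where `b` is a `C¹` vector field and `F` and `U` are
locally integrable: `∫ U φ = - ∫ F div (φ b)` for all test functions `φ`, where
`div (φ b) = b·∇φ + (div b) φ`. -/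
def IsDistribDirDeriv {d : ℕ} (b : Eucl d → Eucl d) (F U : Eucl d → ℝ) : Prop :=
  ∀ φ : Eucl d → ℝ, ContDiff ℝ ∞ φ → HasCompactSupport φ →
    ∫ x, U x * φ x = -∫ x, F x * (fderiv ℝ φ x (b x) + divergence b x * φ x)

end OscSchrodinger

end

/-!
The two claims share one mechanism: both regularity of `H` with respect to `A` and boundedness of the
form `[W(Q), A]` would force the distribution `x·∇W` to be bounded from `H²` to `H⁻²` on functions
living far away from the origin, and this is refuted by explicit oscillating functions.

*From regularity to a bound.* If a resolvent `R = (H - z)⁻¹` is of class `C¹(A)`, the uniform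
boundedness principle gives `‖e^{itA} R e^{-itA} - R‖ ≤ C |t|` (`BoundedIsC1.exists_norm_sub_le`).
The resolvent identity turns this into a bound `C |t|` for the difference of the forms of `H` and of
its dilate (`IsC1.exists_form_sub_le`); the only spectral input is the symmetry of `H` against test
functions. Dividing by `t` and letting `t → 0` bounds the form of `x·∇V` on products `f g` of test
functions supported near infinity (`exists_virial_bound`), where the part `Vc` of the potential is
invisible. On real test functions, the form `[W(Q), A]` is itself, up to the factor `i`, the
distribution `x·∇W` tested on the product (`CommutatorBoundedOnSobolevTwo.exists_virial_bound`). All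
of this uses the weak formulation `-∫ V (d + x·∇)(f g)` of `x·∇V`.

*The test functions.* With a bump `φ` supported in `1 ≤ |y| ≤ 2`, take `f = φ(x / R)` and
`g = cos (k |x|^α) φ(x / R)`. A derivative of `g` costs the local frequency `1 + R^(α-1)`
(`exists_osc_bounds`), so that `‖f‖ ‖g‖ = O(R^d (1 + R^(α-1))²)` for the `H²` norms. The other parts
of the potential contribute no more than that (`WeightedBounded.exists_short_range_bound`,
`exists_short_range_deriv_bound`, `exists_long_range_bound`).

*The contradiction.* The leading part of `x·∇W` is `w k α |x|^(α-β) cos (k |x|^α)`, hence its value on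
`f g` has size `R^(d+α-β)` times `∫ cos² (k R^α |y|^α) φ(y)² dy`. Since `|α - 1| + β < 1` says that
`R^(α-β)` beats `(1 + R^(α-1))²`, this last integral would have to tend to `0` as `R → ∞`. But
`cos² (2 θ) ≥ 1 - 4 cos² θ`, so it cannot be small at two frequencies whose ratio is `2`
(`integral_le_cosSqIntegral`, `not_exists_resonance_bound`).
-/

noncomputable section

namespace OscSchrodinger

/-! ### Real test functions and their operations -/

/-- Real-valued smooth functions on `ℝᵈ` with compact support. -/
structure RealTestFunction (d : ℕ) where
  /-- The underlying function. -/
  toFun : Eucl d → ℝ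
  smooth : ContDiff ℝ ∞ toFun
  compact : HasCompactSupport toFun

namespace RealTestFunction

variable {d : ℕ}

instance : CoeFun (RealTestFunction d) (fun _ => Eucl d → ℝ) := ⟨toFun⟩

theorem differentiable (f : RealTestFunction d) : Differentiable ℝ (f : Eucl d → ℝ) :=
  f.smooth.differentiable (by simp)

theorem continuous (f : RealTestFunction d) : Continuous (f : Eucl d → ℝ) := f.smooth.continuous

theorem exists_bound (f : RealTestFunction d) : ∃ C, 0 ≤ C ∧ ∀ x, |f x| ≤ C := by
  obtain ⟨C, hC⟩ := f.compact.exists_bound_of_continuous f.continuous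
  exact ⟨C, (norm_nonneg _).trans (hC 0), hC⟩

theorem exists_radius (f : RealTestFunction d) : ∃ r, 0 < r ∧ ∀ x, f x ≠ 0 → ‖x‖ ≤ r := by
  obtain ⟨r, hr⟩ := f.compact.isCompact.isBounded.subset_closedBall 0
  refine ⟨max r 1, by positivity, fun x hx => ?_⟩
  have := hr (subset_tsupport _ hx)
  exact (mem_closedBall_zero_iff.mp this).trans (le_max_left _ _)

/-- The pointwise product of two test functions. -/
def mul (f g : RealTestFunction d) : RealTestFunction d where
  toFun x := f x * g x
  smooth := f.smooth.mul g.smooth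
  compact := f.compact.mul_right

/-- The weighted dilation `x ↦ exp (c t) f (exp (t) x)`; the weight `c = d / 2` preserves the `L²`
norm, the weight `c = d` preserves the integral. -/
def dil (c t : ℝ) (f : RealTestFunction d) : RealTestFunction d where
  toFun x := Real.exp (c * t) * f (Real.exp t • x)
  smooth := contDiff_const.mul (f.smooth.comp (contDiff_id.const_smul (Real.exp t)))
  compact := (f.compact.comp_smul (Real.exp_pos t).ne').mul_left

/-- The generator `c + x·∇` of the weighted dilations `dil c t`. -/
def eul (c : ℝ) (f : RealTestFunction d) : RealTestFunction d where
  toFun x := c * f x + fderiv ℝ f x x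
  smooth := (contDiff_const.mul f.smooth).add
    ((f.smooth.fderiv_right (m := ∞) (by simp)).clm_apply contDiff_id)
  compact := by
    refine (f.compact.mul_left).add ((f.compact.fderiv (𝕜 := ℝ)).mono' ?_)
    intro x hx
    apply subset_tsupport
    intro h
    apply hx
    simp [h]

/-- The Laplacian of a test function. -/
def lap (f : RealTestFunction d) : RealTestFunction d where
  toFun := Δ (f : Eucl d → ℝ)
  smooth := by
    rw [InnerProductSpace.laplacian_eq_iteratedFDeriv_orthonormalBasis _
      (EuclideanSpace.basisFun (Fin d) ℝ)]
    refine ContDiff.sum fun i _ => ?_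
    exact (ContinuousMultilinearMap.apply ℝ (fun _ : Fin 2 => Eucl d) ℝ _).contDiff.comp
      (f.smooth.iteratedFDeriv_right (m := ∞) le_rfl)
  compact := by
    rw [InnerProductSpace.laplacian_eq_iteratedFDeriv_orthonormalBasis _
      (EuclideanSpace.basisFun (Fin d) ℝ)]
    refine (f.compact.iteratedFDeriv (𝕜 := ℝ) 2).mono' ?_
    intro x hx
    apply subset_tsupport
    intro h
    apply hx
    simp [h]

theorem eul_apply (c : ℝ) (f : RealTestFunction d) (x : Eucl d) :
    f.eul c x = c * f x + fderiv ℝ f x x := rfl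

theorem dil_apply (c t : ℝ) (f : RealTestFunction d) (x : Eucl d) :
    f.dil c t x = Real.exp (c * t) * f (Real.exp t • x) := rfl

theorem mul_apply (f g : RealTestFunction d) (x : Eucl d) : f.mul g x = f x * g x := rfl

theorem eul_mul (a b : ℝ) (f g : RealTestFunction d) (x : Eucl d) :
    (f.mul g).eul (a + b) x = f.eul a x * g x + f x * g.eul b x := by
  have h : fderiv ℝ (f.mul g) x = f x • fderiv ℝ g x + g x • fderiv ℝ f x :=
    fderiv_fun_mul (f.differentiable x) (g.differentiable x)
  simp only [eul_apply, h, mul_apply, _root_.add_apply,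
    _root_.smul_apply, smul_eq_mul]
  ring

theorem dil_mul (a b t : ℝ) (f g : RealTestFunction d) (x : Eucl d) :
    (f.mul g).dil (a + b) t x = f.dil a t x * g.dil b t x := by
  simp only [dil_apply, mul_apply, add_mul, Real.exp_add]
  ring

theorem lap_dil (c t : ℝ) (f : RealTestFunction d) (x : Eucl d) :
    (f.dil c t).lap x = Real.exp (2 * t) * f.lap.dil c t x := by
  set L : Eucl d →L[ℝ] Eucl d := Real.exp t • ContinuousLinearMap.id ℝ (Eucl d)
  have h1 : (f.dil c t : Eucl d → ℝ) = Real.exp (c * t) • ((f : Eucl d → ℝ) ∘ L) := by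
    ext x; simp [dil_apply, L]
  have hs : ContDiff ℝ ∞ ((f : Eucl d → ℝ) ∘ L) := f.smooth.comp L.contDiff
  change Δ (f.dil c t : Eucl d → ℝ) x = _ * (_ * Δ (f : Eucl d → ℝ) _)
  simp only [InnerProductSpace.laplacian_eq_iteratedFDeriv_orthonormalBasis _
      (EuclideanSpace.basisFun (Fin d) ℝ)]
  rw [Finset.mul_sum, Finset.mul_sum]
  refine Finset.sum_congr rfl fun i _ => ?_
  rw [h1, iteratedFDeriv_const_smul_apply ((hs.of_le ENat.LEInfty.out).contDiffAt),
    L.iteratedFDeriv_comp_right f.smooth x ENat.LEInfty.out]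
  have h2 : (fun j : Fin 2 => L (![EuclideanSpace.basisFun (Fin d) ℝ i,
      EuclideanSpace.basisFun (Fin d) ℝ i] j)) =
      fun j => (fun _ : Fin 2 => Real.exp t) j • ![EuclideanSpace.basisFun (Fin d) ℝ i,
        EuclideanSpace.basisFun (Fin d) ℝ i] j := by
    ext j; simp [L]
  simp only [_root_.smul_apply,
    ContinuousMultilinearMap.compContinuousLinearMap_apply, smul_eq_mul]
  rw [h2, ContinuousMultilinearMap.map_smul_univ]
  have h3 : Real.exp (2 * t) = Real.exp t * Real.exp t := by rw [← Real.exp_add]; ring_nf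
  simp [L, h3]
  ring

/-- Pointwise second-order Taylor estimate for the weighted dilations, with an error supported in a
fixed ball. -/
theorem exists_taylor (c : ℝ) (f : RealTestFunction d) :
    ∃ M r, 0 ≤ M ∧ 0 < r ∧ ∀ t, |t| ≤ 1 → ∀ x,
      |f.dil c t x - f x - t * f.eul c x| ≤
        (Metric.closedBall (0 : Eucl d) r).indicator (fun _ => M * t ^ 2) x := by
  have hderiv : ∀ (g : RealTestFunction d) (x : Eucl d) (t : ℝ),
      HasDerivAt (fun t => g.dil c t x) ((g.eul c).dil c t x) t := by
    intro g x t
    have h1 : HasDerivAt (fun t : ℝ => Real.exp t • x) (Real.exp t • x) t :=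
      (Real.hasDerivAt_exp t).smul_const x
    have h2 := (g.differentiable (Real.exp t • x)).hasFDerivAt.comp_hasDerivAt t h1
    have h3 : HasDerivAt (fun t : ℝ => Real.exp (c * t)) (Real.exp (c * t) * c) t :=
      (hasDerivAt_const_mul c).exp
    refine (h3.mul h2).congr_deriv ?_
    rw [dil_apply, eul_apply, map_smul, Function.comp_apply, smul_eq_mul]
    ring
  have hzero : ∀ (g : RealTestFunction d) (x : Eucl d), g.dil c 0 x = g x := by
    intro g x; simp [dil_apply]
  obtain ⟨C, hC0, hC⟩ := ((f.eul c).eul c).exists_bound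
  obtain ⟨r₁, hr₁, hs₁⟩ := f.exists_radius
  obtain ⟨r₂, hr₂, hs₂⟩ := (f.eul c).exists_radius
  have hexp : ∀ t : ℝ, |t| ≤ 1 → Real.exp (c * t) ≤ Real.exp |c| := by
    intro t ht
    apply Real.exp_le_exp.mpr
    calc c * t ≤ |c * t| := le_abs_self _
      _ = |c| * |t| := abs_mul _ _
      _ ≤ |c| := mul_le_of_le_one_right (abs_nonneg _) ht
  refine ⟨Real.exp |c| * C, Real.exp 1 * r₁ + r₂, by positivity, by positivity, ?_⟩
  intro t ht x
  have hmem : ∀ τ ∈ Set.uIcc 0 t, |τ| ≤ |t| := by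
    intro τ hτ
    simpa using Set.abs_sub_left_of_mem_uIcc hτ
  by_cases hx : x ∈ Metric.closedBall (0 : Eucl d) (Real.exp 1 * r₁ + r₂)
  · rw [Set.indicator_of_mem hx]
    have hfirst : ∀ τ ∈ Set.uIcc 0 t,
        |(f.eul c).dil c τ x - f.eul c x| ≤ Real.exp |c| * C * |t| := by
      intro τ hτ
      have := (convex_uIcc (0 : ℝ) t).norm_image_sub_le_of_norm_hasDerivWithin_le
        (f := fun t => (f.eul c).dil c t x) (C := Real.exp |c| * C)
        (fun s _ => (hderiv (f.eul c) x s).hasDerivWithinAt)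
        (fun s hs => by
          rw [dil_apply, norm_mul, Real.norm_of_nonneg (Real.exp_pos _).le]
          exact mul_le_mul (hexp s ((hmem s hs).trans ht)) (hC _) (norm_nonneg _)
            (Real.exp_pos _).le)
        Set.left_mem_uIcc hτ
      rw [hzero, sub_zero] at this
      exact this.trans (mul_le_mul_of_nonneg_left (hmem τ hτ) (by positivity))
    have := (convex_uIcc (0 : ℝ) t).norm_image_sub_le_of_norm_hasDerivWithin_le
        (f := fun t => f.dil c t x - t * f.eul c x) (C := Real.exp |c| * C * |t|)
        (f' := fun t => (f.eul c).dil c t x - f.eul c x)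
        (fun s _ => ((hderiv f x s).sub
          (by simpa using (hasDerivAt_id s).mul_const (f.eul c x))).hasDerivWithinAt)
        hfirst Set.left_mem_uIcc Set.right_mem_uIcc
    simp only [hzero, zero_mul, sub_zero, Real.norm_eq_abs] at this
    calc |f.dil c t x - f x - t * f.eul c x| = |f.dil c t x - t * f.eul c x - f x| := by
          congr 1; ring
      _ ≤ _ := this
      _ = _ := by rw [mul_assoc, ← pow_two, sq_abs]
  · rw [Set.indicator_of_notMem hx]
    rw [mem_closedBall_zero_iff, not_le] at hx
    have e1 : f x = 0 := by
      by_contra h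
      have h1 := hs₁ x h
      have : 1 ≤ Real.exp 1 := Real.one_le_exp (by norm_num)
      nlinarith
    have e2 : f.eul c x = 0 := by
      by_contra h
      have h1 := hs₂ x h
      have : 0 < Real.exp 1 * r₁ := by positivity
      linarith
    have e3 : f (Real.exp t • x) = 0 := by
      by_contra h
      have h1 := hs₁ _ h
      rw [norm_smul, Real.norm_of_nonneg (Real.exp_pos _).le] at h1
      have h2 : Real.exp (-1) ≤ Real.exp t := Real.exp_le_exp.mpr (abs_le.mp ht).1
      have h3 : Real.exp 1 * Real.exp (-1) = 1 := by rw [← Real.exp_add]; simp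
      have h4 : Real.exp (-1) * ‖x‖ ≤ r₁ :=
        (mul_le_mul_of_nonneg_right h2 (norm_nonneg _)).trans h1
      have h5 : Real.exp 1 * (Real.exp (-1) * ‖x‖) ≤ Real.exp 1 * r₁ :=
        mul_le_mul_of_nonneg_left h4 (Real.exp_pos _).le
      rw [← mul_assoc, h3] at h5
      linarith
    simp [dil_apply, e1, e2, e3]

end RealTestFunction

/-! ### Test functions as vectors of `L²` -/

section Norms

variable {d : ℕ}

theorem norm_le_of_ae_le_indicator {u : L2 d} {M r : ℝ} (hM : 0 ≤ M)
    (h : ∀ᵐ x, ‖u x‖ ≤ (Metric.closedBall (0 : Eucl d) r).indicator (fun _ => M) x) :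
    ‖u‖ ≤ M * √(volume.real (Metric.closedBall (0 : Eucl d) r)) := by
  have hfin : volume (Metric.closedBall (0 : Eucl d) r) ≠ ⊤ := measure_closedBall_lt_top.ne
  have h1 : ‖u‖ ≤ ‖indicatorConstLp (μ := (volume : Measure (Eucl d))) 2
      (measurableSet_closedBall (x := (0 : Eucl d)) (ε := r)) hfin M‖ := by
    refine Lp.norm_le_norm_of_ae_le ?_
    filter_upwards [h, indicatorConstLp_coeFn (μ := (volume : Measure (Eucl d))) (p := 2)
      (hs := measurableSet_closedBall (x := (0 : Eucl d)) (ε := r)) (hμs := hfin) (c := M)]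
      with x hx hx'
    rw [hx']
    exact hx.trans (le_abs_self _)
  refine h1.trans (norm_indicatorConstLp_le.trans (le_of_eq ?_))
  rw [Real.norm_of_nonneg hM, Real.sqrt_eq_rpow]
  simp [Measure.real]

theorem inner_of_ae_eq_real {u v : L2 d} {f g : Eucl d → ℝ} (hu : u =ᵐ[volume] fun x => (f x : ℂ))
    (hv : v =ᵐ[volume] fun x => (g x : ℂ)) : ⟪u, v⟫_ℂ = ((∫ x, f x * g x : ℝ) : ℂ) := by
  rw [L2.inner_def, ← integral_complex_ofReal]
  refine integral_congr_ae ?_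
  filter_upwards [hu, hv] with x hx hx'
  simp [hx, hx', mul_comm]

theorem abs_integral_le_of_ae_le_indicator {h : Eucl d → ℝ} {M r : ℝ}
    (hh : ∀ᵐ x, |h x| ≤ (Metric.closedBall (0 : Eucl d) r).indicator (fun _ => M) x) :
    |∫ x, h x| ≤ M * volume.real (Metric.closedBall (0 : Eucl d) r) := by
  have hi : Integrable ((Metric.closedBall (0 : Eucl d) r).indicator fun _ => M) volume :=
    (integrable_indicator_iff measurableSet_closedBall).mpr
      (integrableOn_const measure_closedBall_lt_top.ne)
  refine (norm_integral_le_of_norm_le (f := h) hi hh).trans (le_of_eq ?_)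
  rw [integral_indicator measurableSet_closedBall, setIntegral_const, smul_eq_mul, mul_comm]

end Norms

namespace RealTestFunction

variable {d : ℕ}

/-- A test function as a complex Schwartz function. -/
def toSchwartz (f : RealTestFunction d) : 𝓢(Eucl d, ℂ) :=
  HasCompactSupport.toSchwartzMap (f := fun x => (f x : ℂ))
    (f.compact.comp_left (g := fun r : ℝ => (r : ℂ)) (by simp))
    (Complex.ofRealCLM.contDiff.comp f.smooth)

theorem toSchwartz_apply (f : RealTestFunction d) (x : Eucl d) : f.toSchwartz x = (f x : ℂ) := rfl

/-- A test function as a vector of `L²(ℝᵈ)`. -/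
def toL2 (f : RealTestFunction d) : L2 d := f.toSchwartz.toLp 2 volume

theorem coeFn_toL2 (f : RealTestFunction d) : f.toL2 =ᵐ[volume] fun x => (f x : ℂ) :=
  f.toSchwartz.coeFn_toLp 2 volume

theorem toL2_mem_sobolevTwo (f : RealTestFunction d) : f.toL2 ∈ sobolevTwo d := by
  change TemperedDistribution.MemSobolev 2 2 (f.toL2 : 𝓢'(Eucl d, ℂ))
  rw [toL2, Lp.toTemperedDistribution_toLp_eq]
  exact SchwartzMap.memSobolev _

theorem laplacian_toSchwartz (f : RealTestFunction d) : Δ f.toSchwartz = f.lap.toSchwartz := by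
  ext x
  rw [SchwartzMap.laplacian_apply, toSchwartz_apply]
  exact (f.smooth.contDiffAt.of_le ENat.LEInfty.out).laplacian_CLM_comp_left
    (l := Complex.ofRealCLM)

theorem toL2_mem_domain_freeHamiltonian (f : RealTestFunction d) :
    f.toL2 ∈ (freeHamiltonian d).domain :=
  f.toL2_mem_sobolevTwo

theorem freeHamiltonian_spec (u : (freeHamiltonian d).domain) :
    (freeHamiltonian d u : 𝓢'(Eucl d, ℂ)) = -Δ ((u : L2 d) : 𝓢'(Eucl d, ℂ)) :=
  (exists_neg_laplacian u).choose_spec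

theorem freeHamiltonian_toL2 (f : RealTestFunction d)
    (hf : f.toL2 ∈ (freeHamiltonian d).domain) :
    freeHamiltonian d ⟨f.toL2, hf⟩ = -f.lap.toL2 := by
  apply toTemperedDistribution_injective
  refine (freeHamiltonian_spec ⟨f.toL2, hf⟩).trans ?_
  change -Δ (f.toL2 : 𝓢'(Eucl d, ℂ)) = _
  rw [← Lp.toTemperedDistributionCLM_apply, ← Lp.toTemperedDistributionCLM_apply, map_neg,
    Lp.toTemperedDistributionCLM_apply, Lp.toTemperedDistributionCLM_apply, toL2, toL2,
    Lp.toTemperedDistribution_toLp_eq, Lp.toTemperedDistribution_toLp_eq,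
    TemperedDistribution.laplacian_toTemperedDistributionCLM_eq, laplacian_toSchwartz]

theorem inner_toL2_eq_distribution (f : RealTestFunction d) (u : L2 d) :
    ⟪f.toL2, u⟫_ℂ = (u : 𝓢'(Eucl d, ℂ)) f.toSchwartz := by
  rw [L2.inner_def, Lp.toTemperedDistribution_apply]
  refine integral_congr_ae ?_
  filter_upwards [f.coeFn_toL2] with x hx
  simp [hx, toSchwartz_apply, mul_comm]

/-- Symmetry of `H₀`, tested against a test function; this is the definition of the distributional
Laplacian. -/
theorem inner_freeHamiltonian_toL2 (f : RealTestFunction d)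
    (hf : f.toL2 ∈ (freeHamiltonian d).domain) (u : (freeHamiltonian d).domain) :
    ⟪freeHamiltonian d ⟨f.toL2, hf⟩, (u : L2 d)⟫_ℂ = ⟪f.toL2, freeHamiltonian d u⟫_ℂ := by
  have h : ((-Δ ((u : L2 d) : 𝓢'(Eucl d, ℂ)) : 𝓢'(Eucl d, ℂ))) f.toSchwartz =
      -((Δ ((u : L2 d) : 𝓢'(Eucl d, ℂ))) f.toSchwartz) := rfl
  rw [freeHamiltonian_toL2, inner_neg_left, inner_toL2_eq_distribution,
    inner_toL2_eq_distribution, freeHamiltonian_spec, h,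
    TemperedDistribution.laplacian_apply_apply, laplacian_toSchwartz]

theorem dilation_toL2 (t : ℝ) (f : RealTestFunction d) :
    dilation d t f.toL2 = (f.dil (d / 2) t).toL2 := by
  have h : (dilation d t f.toL2 : L2 d) =ᵐ[volume]
      fun x => (Real.exp (t * d / 2) : ℂ) * f.toL2 (Real.exp t • x) :=
    MemLp.coeFn_toLp (memLp_dilate t f.toL2)
  apply Lp.ext
  filter_upwards [h, ae_dilate t f.coeFn_toL2, (f.dil (d / 2) t).coeFn_toL2] with x h1 h2 h3
  rw [h1, h2, h3, dil_apply]
  push_cast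
  ring_nf

theorem norm_toL2_le (f : RealTestFunction d) {M r : ℝ} (hM : 0 ≤ M)
    (h : ∀ x, |f x| ≤ (Metric.closedBall (0 : Eucl d) r).indicator (fun _ => M) x) :
    ‖f.toL2‖ ≤ M * √(volume.real (Metric.closedBall (0 : Eucl d) r)) := by
  refine norm_le_of_ae_le_indicator hM ?_
  filter_upwards [f.coeFn_toL2] with x hx
  rw [hx, Complex.norm_real]
  exact h x

/-- Test functions lie in the domain of the generator of dilations, which acts on them as
`-i (d / 2 + x·∇)`. -/
theorem hasDerivAt_dilation_toL2 (f : RealTestFunction d) :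
    HasDerivAt (fun t : ℝ => dilation d t f.toL2) (f.eul (d / 2)).toL2 0 := by
  obtain ⟨M, r, hM, hr, hT⟩ := f.exists_taylor (d / 2)
  set S := √(volume.real (Metric.closedBall (0 : Eucl d) r))
  have h0 : dilation d 0 f.toL2 = f.toL2 := by
    rw [dilation_toL2]; congr 1; cases f; simp [dil]
  have key : ∀ t : ℝ, |t| ≤ 1 →
      ‖dilation d t f.toL2 - f.toL2 - t • (f.eul (d / 2)).toL2‖ ≤ M * S * t ^ 2 := by
    intro t ht
    rw [dilation_toL2, mul_right_comm]
    refine norm_le_of_ae_le_indicator (by positivity) ?_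
    filter_upwards [Lp.coeFn_sub ((f.dil (d / 2) t).toL2 - f.toL2) (t • (f.eul (d / 2)).toL2),
      Lp.coeFn_sub (f.dil (d / 2) t).toL2 f.toL2, Lp.coeFn_smul t (f.eul (d / 2)).toL2,
      f.coeFn_toL2, (f.dil (d / 2) t).coeFn_toL2, (f.eul (d / 2)).coeFn_toL2]
      with x h1 h2 h3 h4 h5 h6
    rw [h1, Pi.sub_apply, h2, Pi.sub_apply, h3, Pi.smul_apply, h4, h5, h6]
    refine le_trans (le_of_eq ?_) (hT t ht x)
    rw [Complex.real_smul, ← Complex.ofReal_mul, ← Complex.ofReal_sub, ← Complex.ofReal_sub,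
      Complex.norm_real, Real.norm_eq_abs]
  rw [hasDerivAt_iff_isLittleO_nhds_zero]
  have hO : (fun t : ℝ => dilation d (0 + t) f.toL2 - dilation d 0 f.toL2 -
      t • (f.eul (d / 2)).toL2) =O[nhds 0] fun t : ℝ => t ^ 2 := by
    refine Asymptotics.IsBigO.of_bound (M * S) ?_
    filter_upwards [Metric.closedBall_mem_nhds (0 : ℝ) one_pos] with t ht
    rw [zero_add, h0, Real.norm_of_nonneg (sq_nonneg t)]
    exact key t (by simpa using ht)
  refine hO.trans_isLittleO ?_
  simpa using Asymptotics.isLittleO_pow_pow (𝕜 := ℝ) (m := 1) (n := 2) (by norm_num)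

theorem toL2_mem_domain_dilationGenerator (f : RealTestFunction d) :
    f.toL2 ∈ (dilationGenerator d).domain :=
  f.hasDerivAt_dilation_toL2.differentiableAt

theorem dilationGenerator_toL2 (f : RealTestFunction d)
    (hf : f.toL2 ∈ (dilationGenerator d).domain) :
    dilationGenerator d ⟨f.toL2, hf⟩ = (-Complex.I) • (f.eul (d / 2)).toL2 := by
  change (-Complex.I) • deriv (fun t : ℝ => dilation d t f.toL2) 0 = _
  rw [f.hasDerivAt_dilation_toL2.deriv]

theorem toL2_mem_mulDomain (f : RealTestFunction d) {V : Eucl d → ℝ} (hV : AEMeasurable V volume)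
    {C : ℝ} (hb : ∀ᵐ x, f x ≠ 0 → |V x| ≤ C) : f.toL2 ∈ mulDomain V := by
  change MemLp (fun x => (V x : ℂ) * f.toL2 x) 2 volume
  refine (Lp.memLp f.toL2).of_le_mul (c := C) ?_ ?_
  · exact (Complex.measurable_ofReal.comp_aemeasurable hV).aestronglyMeasurable.mul
      (Lp.aestronglyMeasurable _)
  · filter_upwards [hb, f.coeFn_toL2] with x hx hx'
    rw [hx', norm_mul, Complex.norm_real, Complex.norm_real]
    by_cases h : f x = 0
    · simp [h]
    · exact mul_le_mul_of_nonneg_right (hx h) (norm_nonneg _)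

theorem coeFn_mulOp_toL2 (f : RealTestFunction d) {V : Eucl d → ℝ}
    (hf : f.toL2 ∈ (mulOp V).domain) :
    (mulOp V ⟨f.toL2, hf⟩ : L2 d) =ᵐ[volume] fun x => ((V x * f x : ℝ) : ℂ) := by
  have h : (mulOp V ⟨f.toL2, hf⟩ : L2 d) =ᵐ[volume] fun x => (V x : ℂ) * f.toL2 x :=
    MemLp.coeFn_toLp hf
  filter_upwards [h, f.coeFn_toL2] with x h1 h2
  rw [h1, h2, Complex.ofReal_mul]

/-- Let `V` be bounded. If the form of `V` moves at most linearly under dilation of `F`, then the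
distribution `x·∇V`, tested on `F`, obeys the same bound. -/
theorem abs_integral_mul_eul_le (F : RealTestFunction d) {V : Eucl d → ℝ} {C A : ℝ}
    (hV : AEMeasurable V volume) (hb : ∀ᵐ x, |V x| ≤ C)
    (hA : ∀ t, 0 < t → t ≤ 1 → |(∫ x, V x * F.dil d (-t) x) - ∫ x, V x * F x| ≤ A * t) :
    |∫ x, V x * F.eul d x| ≤ A := by
  have hint : ∀ G : RealTestFunction d, Integrable (fun x => V x * G x) volume := by
    intro G
    exact (G.continuous.integrable_of_hasCompactSupport G.compact).bdd_mul
      hV.aestronglyMeasurable hb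
  obtain ⟨M, r, hM, hr, hT⟩ := F.exists_taylor d
  set S := volume.real (Metric.closedBall (0 : Eucl d) r)
  have hC : 0 ≤ C := by
    obtain ⟨x, hx⟩ := hb.exists
    exact (abs_nonneg _).trans hx
  have key : ∀ t, 0 < t → t ≤ 1 → |∫ x, V x * F.eul d x| ≤ A + C * M * S * t := by
    intro t ht ht1
    have h1 : |∫ x, V x * (F.dil d (-t) x - F x - (-t) * F.eul d x)| ≤ C * (M * t ^ 2) * S := by
      refine abs_integral_le_of_ae_le_indicator ?_
      filter_upwards [hb] with x hx
      have := hT (-t) (by rwa [abs_neg, abs_of_pos ht]) x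
      rw [abs_mul]
      refine (mul_le_mul hx this (abs_nonneg _) hC).trans (le_of_eq ?_)
      by_cases hm : x ∈ Metric.closedBall (0 : Eucl d) r <;> simp [hm]
    have h2 : ∫ x, V x * (F.dil d (-t) x - F x - (-t) * F.eul d x) =
        ((∫ x, V x * F.dil d (-t) x) - ∫ x, V x * F x) + t * ∫ x, V x * F.eul d x := by
      rw [← integral_const_mul, ← integral_sub (hint _) (hint _),
        ← integral_add (f := fun x => V x * F.dil d (-t) x - V x * F x)
          ((hint _).sub (hint _)) ((hint _).const_mul _)]
      refine integral_congr_ae (Filter.Eventually.of_forall fun x => ?_)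
      simp only
      ring
    rw [h2] at h1
    have h3 := hA t ht ht1
    have h4 : |t * ∫ x, V x * F.eul d x| ≤ C * (M * t ^ 2) * S + A * t := by
      have := abs_sub (((∫ x, V x * F.dil d (-t) x) - ∫ x, V x * F x) +
        t * ∫ x, V x * F.eul d x) ((∫ x, V x * F.dil d (-t) x) - ∫ x, V x * F x)
      rw [add_sub_cancel_left] at this
      linarith
    rw [abs_mul, abs_of_pos ht] at h4
    have h5 : t * |∫ x, V x * F.eul d x| ≤ t * (A + C * M * S * t) := by
      refine h4.trans (le_of_eq ?_); ring
    exact le_of_mul_le_mul_left h5 ht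
  refine le_of_forall_pos_le_add fun ε hε => ?_
  have hK : 0 ≤ C * M * S := by positivity
  set t := min 1 (ε / (C * M * S + 1))
  have ht : 0 < t := by positivity
  refine (key t ht (min_le_left _ _)).trans ?_
  have : C * M * S * t ≤ (C * M * S + 1) * (ε / (C * M * S + 1)) :=
    mul_le_mul (by linarith) (min_le_right _ _) ht.le (by positivity)
  rw [mul_div_cancel₀ _ (by positivity)] at this
  linarith

/-- The divergence theorem for the Euler field: `∫ div (x F) = 0`. -/
theorem integral_eul (F : RealTestFunction d) : ∫ x, F.eul d x = 0 := by
  have h := F.abs_integral_mul_eul_le (V := fun _ => 1) (C := 1) (A := 0) aemeasurable_const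
    (by simp) (by
      intro t _ _
      have h1 : ∫ x, F.dil d (-t) x = ∫ x, F x := by
        have h2 : |(Real.exp (-t) ^ Module.finrank ℝ (Eucl d))⁻¹| = Real.exp (d * t) := by
          rw [abs_of_pos (by positivity), ← Real.exp_nat_mul, ← Real.exp_neg]
          simp
        simp only [dil_apply]
        rw [integral_const_mul, Measure.integral_comp_smul, h2, smul_eq_mul, ← mul_assoc,
          ← Real.exp_add]
        simp
      simp [h1])
  simpa using h

end RealTestFunction

/-! ### Consequences of `C¹` regularity of the resolvent -/

section AbstractRegularity

variable {𝓗 : Type*} [NormedAddCommGroup 𝓗] [InnerProductSpace ℂ 𝓗]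

/-- By the uniform boundedness principle, a `C¹` bounded operator is Lipschitz in operator norm
along the group. -/
theorem BoundedIsC1.exists_norm_sub_le [CompleteSpace 𝓗] {U : ℝ → 𝓗 →ₗᵢ[ℂ] 𝓗} {T : 𝓗 →L[ℂ] 𝓗}
    (hU : ∀ f, U 0 f = f) (hT : BoundedIsC1 U T) :
    ∃ C, 0 ≤ C ∧ ∀ t, 0 < t → t ≤ 1 → ∀ f, ‖U t (T (U (-t) f)) - T f‖ ≤ C * t * ‖f‖ := by
  let D : Set.Ioc (0 : ℝ) 1 → 𝓗 →L[ℂ] 𝓗 := fun t =>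
    ((t : ℝ)⁻¹ : ℂ) • (((U t).toContinuousLinearMap.comp
      (T.comp (U (-t)).toContinuousLinearMap)) - T)
  have hD : ∀ t f, ‖D t f‖ = (t : ℝ)⁻¹ * ‖U t (T (U (-t) f)) - T f‖ := by
    intro t f
    have ht : 0 < (t : ℝ) := t.2.1
    simp [D, norm_smul, abs_of_pos ht]
  obtain ⟨C, hC⟩ := banach_steinhaus (g := D) (by
    intro f
    have hc := hT f
    obtain ⟨C, hC⟩ := isCompact_Icc.exists_bound_of_continuousOn (s := Set.Icc (0 : ℝ) 1)
      (hc.continuous_deriv le_rfl).continuousOn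
    refine ⟨C, fun t => ?_⟩
    have ht : 0 < (t : ℝ) := t.2.1
    have h := (convex_Icc (0 : ℝ) 1).norm_image_sub_le_of_norm_hasDerivWithin_le
      (fun s _ => ((hc.differentiable (by simp)) s).hasDerivAt.hasDerivWithinAt) hC
      (Set.left_mem_Icc.mpr zero_le_one) ⟨ht.le, t.2.2⟩
    simp only [neg_zero, hU, sub_zero, Real.norm_of_nonneg ht.le] at h
    rw [hD, inv_mul_le_iff₀ ht, mul_comm]
    exact h)
  refine ⟨max C 0, le_max_right _ _, fun t ht ht1 f => ?_⟩
  have h1 := (D ⟨t, ht, ht1⟩).le_opNorm f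
  rw [hD, inv_mul_le_iff₀ ht] at h1
  refine h1.trans ?_
  have h2 := (hC ⟨t, ht, ht1⟩).trans (le_max_left C 0)
  calc t * (‖D ⟨t, ht, ht1⟩‖ * ‖f‖) ≤ t * (max C 0 * ‖f‖) := by gcongr
    _ = _ := by ring

/-- If `N` is of class `C¹(M)`, its form moves at most linearly along the group. The resolvent
identity turns the difference of the forms of `N` and of its conjugate by `exp (i t M)` into the
difference of the resolvents; only the symmetry of `N` against the one vector `f'` enters. -/
theorem IsC1.exists_form_sub_le [CompleteSpace 𝓗] {U : ℝ → 𝓗 →ₗᵢ[ℂ] 𝓗} {N : 𝓗 →ₗ.[ℂ] 𝓗}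
    (hU : ∀ f, U 0 f = f) (hUn : ∀ t f, U t (U (-t) f) = f) (hN : IsC1 U N) :
    ∃ C, 0 ≤ C ∧ ∀ t, 0 < t → t ≤ 1 → ∀ (f : 𝓗) (f' g g' : N.domain),
      (f' : 𝓗) = U (-t) f → (g' : 𝓗) = U (-t) g →
      (∀ u : N.domain, ⟪N f', (u : 𝓗)⟫_ℂ = ⟪(f' : 𝓗), N u⟫_ℂ) →
      ‖⟪f, N g⟫_ℂ - ⟪(f' : 𝓗), N g'⟫_ℂ‖ ≤
        C * t * (‖N f'‖ + ‖(f' : 𝓗)‖) * (‖N g‖ + ‖(g : 𝓗)‖) := by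
  obtain ⟨z, R, ⟨hR₁, hR₂⟩, hR⟩ := hN
  obtain ⟨C, hC0, hC⟩ := hR.exists_norm_sub_le hU
  refine ⟨C * (1 + ‖z‖) * (1 + ‖z‖), by positivity, ?_⟩
  intro t ht ht1 f f' g g' hf' hg' hsym
  set h : 𝓗 := N g - z • (g : 𝓗) with hh
  -- `u` is `U (-t)` applied to the difference of the resolvents at `h = (N - z) g`
  obtain ⟨u, hu, huN⟩ := hR₁ (U (-t) h - (N g' - z • (g' : 𝓗)))
  have hRg : R h = g := hR₂ g
  have hu' : (u : 𝓗) = R (U (-t) h) - U (-t) (g : 𝓗) := by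
    rw [hu, map_sub, hR₂ g', hg']
  have hnu : ‖(u : 𝓗)‖ ≤ C * t * ‖h‖ := by
    have h1 := hC t ht ht1 h
    rw [hRg] at h1
    rw [← (U t).norm_map, hu', map_sub, hUn]
    exact h1
  have hform : ⟪N f' - (starRingEnd ℂ z) • (f' : 𝓗), (u : 𝓗)⟫_ℂ =
      ⟪f, N g⟫_ℂ - ⟪(f' : 𝓗), N g'⟫_ℂ := by
    rw [inner_sub_left, hsym, inner_smul_left, Complex.conj_conj, ← inner_smul_right,
      ← inner_sub_right, huN, inner_sub_right, hf', (U (-t)).inner_map_map, hh, inner_sub_right,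
      inner_sub_right, inner_smul_right, inner_smul_right, hg', (U (-t)).inner_map_map]
    ring
  rw [← hform]
  have e1 : ‖N f' - (starRingEnd ℂ z) • (f' : 𝓗)‖ ≤ (1 + ‖z‖) * (‖N f'‖ + ‖(f' : 𝓗)‖) := by
    refine (norm_sub_le _ _).trans ?_
    rw [norm_smul, RCLike.norm_conj]
    nlinarith [norm_nonneg z, norm_nonneg (N f'), norm_nonneg (f' : 𝓗),
      mul_nonneg (norm_nonneg z) (norm_nonneg (N f'))]
  have e2 : ‖h‖ ≤ (1 + ‖z‖) * (‖N g‖ + ‖(g : 𝓗)‖) := by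
    refine (norm_sub_le _ _).trans ?_
    rw [norm_smul]
    nlinarith [norm_nonneg z, norm_nonneg (N g), norm_nonneg (g : 𝓗),
      mul_nonneg (norm_nonneg z) (norm_nonneg (N g))]
  calc _ ≤ ‖N f' - (starRingEnd ℂ z) • (f' : 𝓗)‖ * ‖(u : 𝓗)‖ := norm_inner_le_norm _ _
    _ ≤ ((1 + ‖z‖) * (‖N f'‖ + ‖(f' : 𝓗)‖)) *
        (C * t * ((1 + ‖z‖) * (‖N g‖ + ‖(g : 𝓗)‖))) :=
      mul_le_mul e1 (hnu.trans (mul_le_mul_of_nonneg_left e2 (by positivity)))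
        (norm_nonneg _) (by positivity)
    _ = _ := by ring

end AbstractRegularity

namespace RealTestFunction

variable {d : ℕ}

/-- The size `‖f‖ + ‖Δ f‖` of a test function, equivalent to its `H²` norm. -/
def size (f : RealTestFunction d) : ℝ := ‖f.toL2‖ + ‖f.lap.toL2‖

theorem size_nonneg (f : RealTestFunction d) : 0 ≤ f.size := by unfold size; positivity

theorem norm_toL2_le_size (f : RealTestFunction d) : ‖f.toL2‖ ≤ f.size :=
  le_add_of_nonneg_right (norm_nonneg _)

theorem norm_lap_toL2_le_size (f : RealTestFunction d) : ‖f.lap.toL2‖ ≤ f.size :=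
  le_add_of_nonneg_left (norm_nonneg _)

/-- The covariance of the Laplacian under the unitary dilations. -/
theorem lap_dil_toL2 (t : ℝ) (f : RealTestFunction d) :
    (f.dil (d / 2) t).lap.toL2 = (Real.exp (2 * t) : ℂ) • dilation d t f.lap.toL2 := by
  rw [dilation_toL2]
  apply Lp.ext
  filter_upwards [coeFn_toL2 (f.dil (d / 2) t).lap, coeFn_toL2 (f.lap.dil (d / 2) t),
    Lp.coeFn_smul (Real.exp (2 * t) : ℂ) (f.lap.dil (d / 2) t).toL2] with x h1 h2 h3
  rw [h1, h3, Pi.smul_apply, h2, lap_dil, Complex.ofReal_mul, smul_eq_mul]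

theorem size_dil_le {t : ℝ} (ht : t ≤ 0) (f : RealTestFunction d) :
    (f.dil (d / 2) t).size ≤ f.size := by
  unfold size
  rw [lap_dil_toL2, norm_smul, ← dilation_toL2, LinearIsometry.norm_map,
    LinearIsometry.norm_map, Complex.norm_real, Real.norm_of_nonneg (Real.exp_pos _).le]
  have : Real.exp (2 * t) ≤ 1 := Real.exp_le_one_iff.mpr (by linarith)
  have := mul_le_of_le_one_left (norm_nonneg f.lap.toL2) this
  linarith

end RealTestFunction

section Schrodinger

variable {d : ℕ}

open RealTestFunction

theorem dilation_zero_apply (f : L2 d) : dilation d 0 f = f := by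
  have h : (dilation d 0 f : L2 d) =ᵐ[volume]
      fun x => (Real.exp ((0 : ℝ) * d / 2) : ℂ) * f (Real.exp 0 • x) :=
    MemLp.coeFn_toLp (memLp_dilate 0 f)
  apply Lp.ext
  filter_upwards [h] with x hx
  rw [hx]
  simp

theorem dilation_dilation_neg (t : ℝ) (f : L2 d) : dilation d t (dilation d (-t) f) = f := by
  have h1 : (dilation d t (dilation d (-t) f) : L2 d) =ᵐ[volume]
      fun x => (Real.exp (t * d / 2) : ℂ) * dilation d (-t) f (Real.exp t • x) :=
    MemLp.coeFn_toLp (memLp_dilate t _)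
  have h2 : (dilation d (-t) f : L2 d) =ᵐ[volume]
      fun x => (Real.exp (-t * d / 2) : ℂ) * f (Real.exp (-t) • x) :=
    MemLp.coeFn_toLp (memLp_dilate (-t) f)
  apply Lp.ext
  filter_upwards [h1, ae_dilate t h2] with x hx hx'
  rw [hx, hx', smul_smul, ← mul_assoc, ← Complex.ofReal_mul, ← Real.exp_add, ← Real.exp_add]
  ring_nf
  simp

theorem schrodinger_toL2 {V : Eucl d → ℝ} (f : RealTestFunction d)
    (hf : f.toL2 ∈ (schrodinger V).domain) :
    schrodinger V ⟨f.toL2, hf⟩ = -f.lap.toL2 + mulOp V ⟨f.toL2, hf.2⟩ := by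
  rw [← freeHamiltonian_toL2 f hf.1]
  exact LinearPMap.add_apply (freeHamiltonian d) (mulOp V) ⟨f.toL2, hf⟩

theorem inner_mulOp {V : Eucl d → ℝ} (u v : (mulOp V).domain) :
    ⟪mulOp V u, (v : L2 d)⟫_ℂ = ⟪(u : L2 d), mulOp V v⟫_ℂ := by
  have h : ∀ w : (mulOp V).domain,
      (mulOp V w : L2 d) =ᵐ[volume] fun x => (V x : ℂ) * (w : L2 d) x :=
    fun w => MemLp.coeFn_toLp w.2
  rw [L2.inner_def, L2.inner_def]
  refine integral_congr_ae ?_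
  filter_upwards [h u, h v] with x hx hx'
  rw [hx, hx']
  simp
  ring

theorem inner_schrodinger_toL2 {V : Eucl d → ℝ} (f : RealTestFunction d)
    (hf : f.toL2 ∈ (schrodinger V).domain) (u : (schrodinger V).domain) :
    ⟪schrodinger V ⟨f.toL2, hf⟩, (u : L2 d)⟫_ℂ = ⟪f.toL2, schrodinger V u⟫_ℂ := by
  have h : schrodinger V u =
      freeHamiltonian d ⟨u, u.2.1⟩ + mulOp V ⟨u, u.2.2⟩ :=
    LinearPMap.add_apply (freeHamiltonian d) (mulOp V) u
  rw [schrodinger_toL2, h, inner_add_left, inner_add_right,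
    ← inner_freeHamiltonian_toL2 f hf.1 ⟨u, u.2.1⟩, freeHamiltonian_toL2,
    inner_mulOp ⟨f.toL2, hf.2⟩ ⟨u, u.2.2⟩]

/-- If the Schrödinger operator is of class `C¹(A)` and its potential coincides near infinity with a
bounded function `V`, then the distribution `x·∇V` is bounded from `H²` to `H⁻²` on products of test
functions supported near infinity. -/
theorem exists_virial_bound {W V : Eucl d → ℝ} {r C₀ : ℝ} (hW : AEMeasurable W volume)
    (hV : AEMeasurable V volume) (hVb : ∀ᵐ x, |V x| ≤ C₀) (hWV : ∀ x, r ≤ ‖x‖ → W x = V x)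
    (hC1 : IsC1 (dilation d) (schrodinger W)) :
    ∃ K, ∀ f g : RealTestFunction d, (∀ x, f x ≠ 0 → r ≤ ‖x‖) → (∀ x, g x ≠ 0 → r ≤ ‖x‖) →
      |∫ x, V x * (f.mul g).eul d x| ≤ K * f.size * g.size := by
  obtain ⟨C, hC0, hC⟩ := hC1.exists_form_sub_le dilation_zero_apply dilation_dilation_neg
  have hC₀ : 0 ≤ C₀ := by
    obtain ⟨x, hx⟩ := hVb.exists
    exact (abs_nonneg _).trans hx
  have hmul : ∀ f : RealTestFunction d, (∀ x, f x ≠ 0 → r ≤ ‖x‖) → f.toL2 ∈ (mulOp W).domain := by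
    intro f hf
    refine f.toL2_mem_mulDomain hW (C := C₀) ?_
    filter_upwards [hVb] with x hx hfx
    rwa [hWV x (hf x hfx)]
  have hmulV : ∀ (f : RealTestFunction d) (hf : ∀ x, f x ≠ 0 → r ≤ ‖x‖),
      (mulOp W ⟨f.toL2, hmul f hf⟩ : L2 d) =ᵐ[volume] fun x => ((V x * f x : ℝ) : ℂ) := by
    intro f hf
    filter_upwards [f.coeFn_mulOp_toL2 (hmul f hf)] with x hx
    rw [hx]
    by_cases h : f x = 0
    · simp [h]
    · rw [hWV x (hf x h)]
  have hdom : ∀ f : RealTestFunction d, (∀ x, f x ≠ 0 → r ≤ ‖x‖) →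
      f.toL2 ∈ (schrodinger W).domain :=
    fun f hf => ⟨f.toL2_mem_domain_freeHamiltonian, hmul f hf⟩
  have hnorm : ∀ (f : RealTestFunction d) (hf : ∀ x, f x ≠ 0 → r ≤ ‖x‖),
      ‖schrodinger W ⟨f.toL2, hdom f hf⟩‖ + ‖f.toL2‖ ≤ (1 + C₀) * f.size := by
    intro f hf
    have h1 : ‖mulOp W ⟨f.toL2, hmul f hf⟩‖ ≤ C₀ * ‖f.toL2‖ := by
      refine Lp.norm_le_mul_norm_of_ae_le_mul ?_
      filter_upwards [hmulV f hf, f.coeFn_toL2, hVb] with x h1 h2 h3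
      rw [h1, h2, Complex.norm_real, Complex.norm_real, norm_mul]
      exact mul_le_mul_of_nonneg_right h3 (norm_nonneg _)
    rw [schrodinger_toL2]
    have h2 := norm_add_le (-f.lap.toL2) (mulOp W ⟨f.toL2, hmul f hf⟩)
    rw [norm_neg] at h2
    have h3 := mul_nonneg hC₀ (norm_nonneg f.lap.toL2)
    unfold size
    linarith
  have hform : ∀ (f g : RealTestFunction d) (hg : ∀ x, g x ≠ 0 → r ≤ ‖x‖),
      ⟪f.toL2, schrodinger W ⟨g.toL2, hdom g hg⟩⟫_ℂ =
        -⟪f.toL2, g.lap.toL2⟫_ℂ + ((∫ x, V x * f.mul g x : ℝ) : ℂ) := by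
    intro f g hg
    rw [schrodinger_toL2, inner_add_right, inner_neg_right,
      inner_of_ae_eq_real f.coeFn_toL2 (hmulV g hg)]
    congr 3
    ext x
    rw [mul_apply]
    ring
  refine ⟨C * (1 + C₀) * (1 + C₀) + 2, fun f g hf hg => ?_⟩
  refine (f.mul g).abs_integral_mul_eul_le hV hVb fun t ht ht1 => ?_
  have hsupp : ∀ h : RealTestFunction d, (∀ x, h x ≠ 0 → r ≤ ‖x‖) →
      ∀ x, h.dil (d / 2) (-t) x ≠ 0 → r ≤ ‖x‖ := by
    intro h hh x hx
    have h1 := hh _ (right_ne_zero_of_mul hx)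
    rw [norm_smul, Real.norm_of_nonneg (Real.exp_pos _).le] at h1
    exact h1.trans (mul_le_of_le_one_left (norm_nonneg _) (Real.exp_le_one_iff.mpr (by linarith)))
  set f' := f.dil (d / 2) (-t) with hf'
  set g' := g.dil (d / 2) (-t) with hg'
  have key := hC t ht ht1 f.toL2 ⟨f'.toL2, hdom f' (hsupp f hf)⟩ ⟨g.toL2, hdom g hg⟩
    ⟨g'.toL2, hdom g' (hsupp g hg)⟩ (dilation_toL2 (-t) f).symm (dilation_toL2 (-t) g).symm
    (inner_schrodinger_toL2 f' _)
  have hlap : ⟪f'.toL2, g'.lap.toL2⟫_ℂ = (Real.exp (2 * -t) : ℂ) * ⟪f.toL2, g.lap.toL2⟫_ℂ := by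
    rw [hf', hg', lap_dil_toL2, inner_smul_right, ← dilation_toL2, LinearIsometry.inner_map_map]
  have hprod : ∀ x, f'.mul g' x = (f.mul g).dil d (-t) x := by
    intro x
    have := dil_mul ((d : ℝ) / 2) (d / 2) (-t) f g x
    rw [add_halves] at this
    rw [this, mul_apply]
  dsimp only at key
  rw [hform f g hg, hform f' g' (hsupp g hg), hlap] at key
  simp only [hprod] at key
  have hexp : |Real.exp (2 * -t) - 1| ≤ 2 * t := by
    rw [abs_sub_comm, abs_of_nonneg (sub_nonneg.mpr (Real.exp_le_one_iff.mpr (by linarith)))]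
    linarith [Real.add_one_le_exp (2 * -t)]
  have hrem : ‖((Real.exp (2 * -t) - 1 : ℝ) : ℂ) * ⟪f.toL2, g.lap.toL2⟫_ℂ‖ ≤
      2 * t * (f.size * g.size) := by
    rw [norm_mul, Complex.norm_real, Real.norm_eq_abs]
    refine mul_le_mul hexp ?_ (norm_nonneg _) (by positivity)
    exact (norm_inner_le_norm _ _).trans (mul_le_mul f.norm_toL2_le_size g.norm_lap_toL2_le_size
      (norm_nonneg _) f.size_nonneg)
  have hmain : C * t * (‖schrodinger W ⟨f'.toL2, hdom f' (hsupp f hf)⟩‖ + ‖f'.toL2‖) *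
      (‖schrodinger W ⟨g.toL2, hdom g hg⟩‖ + ‖g.toL2‖) ≤
      C * t * ((1 + C₀) * f.size) * ((1 + C₀) * g.size) := by
    have h1 := (hnorm f' (hsupp f hf)).trans
      (mul_le_mul_of_nonneg_left (size_dil_le (t := -t) (by linarith) f) (by positivity))
    have h2 := hnorm g hg
    have h3 := f.size_nonneg
    gcongr
  have hsplit : (((∫ x, V x * (f.mul g).dil d (-t) x) - ∫ x, V x * f.mul g x : ℝ) : ℂ) =
      ((Real.exp (2 * -t) - 1 : ℝ) : ℂ) * ⟪f.toL2, g.lap.toL2⟫_ℂ -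
      (-⟪f.toL2, g.lap.toL2⟫_ℂ + ((∫ x, V x * f.mul g x : ℝ) : ℂ) -
        (-((Real.exp (2 * -t) : ℂ) * ⟪f.toL2, g.lap.toL2⟫_ℂ) +
          ((∫ x, V x * (f.mul g).dil d (-t) x : ℝ) : ℂ))) := by
    push_cast
    ring
  rw [← Real.norm_eq_abs, ← Complex.norm_real, hsplit]
  refine (norm_sub_le _ _).trans ((add_le_add hrem (key.trans hmain)).trans (le_of_eq ?_))
  ring

/-- The same bound when the commutator form of `V(Q)` with the generator of dilations is bounded
from `H²` to `H⁻²`: on real test functions this form is the distribution `x·∇V`. -/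
theorem CommutatorBoundedOnSobolevTwo.exists_virial_bound {V : Eucl d → ℝ} {C₀ : ℝ}
    (hV : AEMeasurable V volume) (hVb : ∀ᵐ x, |V x| ≤ C₀)
    (hc : CommutatorBoundedOnSobolevTwo (mulOp V)) :
    ∃ K, ∀ f g : RealTestFunction d, |∫ x, V x * (f.mul g).eul d x| ≤ K * f.size * g.size := by
  obtain ⟨C, hC⟩ := hc
  have hmul : ∀ f : RealTestFunction d, f.toL2 ∈ (mulOp V).domain :=
    fun f => f.toL2_mem_mulDomain hV (hVb.mono fun x hx _ => hx)
  have hsob : ∀ f : RealTestFunction d, sobolevTwoNorm ⟨f.toL2, f.toL2_mem_sobolevTwo⟩ ≤ f.size := by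
    intro f
    change ‖f.toL2 + freeHamiltonian d ⟨f.toL2, f.toL2_mem_domain_freeHamiltonian⟩‖ ≤ _
    rw [freeHamiltonian_toL2 f f.toL2_mem_domain_freeHamiltonian]
    refine (norm_add_le _ _).trans (le_of_eq ?_)
    rw [norm_neg, size]
  have hint : ∀ F : RealTestFunction d, Integrable (fun x => V x * F x) volume := fun F =>
    (F.continuous.integrable_of_hasCompactSupport F.compact).bdd_mul hV.aestronglyMeasurable hVb
  refine ⟨max C 0, fun f g => ?_⟩
  have h := hC f.toL2 g.toL2 ⟨hmul f, f.toL2_mem_domain_dilationGenerator⟩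
    ⟨hmul g, g.toL2_mem_domain_dilationGenerator⟩ f.toL2_mem_sobolevTwo g.toL2_mem_sobolevTwo
  have hform : commutatorForm (mulOp V) (dilationGenerator d)
      ⟨f.toL2, hmul f, f.toL2_mem_domain_dilationGenerator⟩
      ⟨g.toL2, hmul g, g.toL2_mem_domain_dilationGenerator⟩ =
      -Complex.I * ((∫ x, V x * (f.mul g).eul d x : ℝ) : ℂ) := by
    have e1 : ∫ x, V x * (f.mul g).eul d x =
        (∫ x, V x * f x * g.eul (d / 2) x) + ∫ x, f.eul (d / 2) x * (V x * g x) := by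
      rw [← integral_add]
      · refine integral_congr_ae (Filter.Eventually.of_forall fun x => ?_)
        have := eul_mul ((d : ℝ) / 2) (d / 2) f g x
        rw [add_halves] at this
        simp only [this]
        ring
      · convert hint (f.mul (g.eul (d / 2))) using 2
        rw [mul_apply]; ring
      · convert hint ((f.eul (d / 2)).mul g) using 2
        rw [mul_apply]; ring
    unfold commutatorForm
    simp only
    rw [dilationGenerator_toL2, dilationGenerator_toL2, inner_smul_right, inner_smul_left,
      inner_of_ae_eq_real (f.coeFn_mulOp_toL2 (hmul f)) (g.eul (d / 2)).coeFn_toL2,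
      inner_of_ae_eq_real (f.eul (d / 2)).coeFn_toL2 (g.coeFn_mulOp_toL2 (hmul g)), e1]
    simp
    ring
  rw [hform, norm_mul, norm_neg, Complex.norm_I, one_mul, Complex.norm_real, Real.norm_eq_abs] at h
  refine h.trans ?_
  have hn : ∀ u : sobolevTwo d, 0 ≤ sobolevTwoNorm u := fun u => norm_nonneg _
  have h3 := f.size_nonneg
  calc _ ≤ max C 0 * sobolevTwoNorm ⟨f.toL2, f.toL2_mem_sobolevTwo⟩ *
        sobolevTwoNorm ⟨g.toL2, g.toL2_mem_sobolevTwo⟩ := by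
        gcongr
        · exact hn _
        · exact hn _
        · exact le_max_left _ _
    _ ≤ max C 0 * f.size * g.size := by
        gcongr
        · exact hn _
        · exact hsob f
        · exact hsob g

end Schrodinger

/-! ### Oscillating test functions on large annuli -/

section RadialPower

variable {d : ℕ}

/-- A bump function near the origin, which removes the singularity of powers of `|y|`. -/
def originBump (d : ℕ) : ContDiffBump (0 : Eucl d) where
  rIn := 1 / 4
  rOut := 1 / 2
  rIn_pos := by norm_num
  rIn_lt_rOut := by norm_num

/-- A smooth function on `ℝᵈ` which equals `|y|^p` for `|y| ≥ 1 / 2`. -/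
def radialPow (p : ℝ) (y : Eucl d) : ℝ := (‖y‖ ^ 2 + originBump d y) ^ (p / 2)

/-- The base of `radialPow` never vanishes, so its real powers are smooth. -/
theorem radialPow_base_pos (y : Eucl d) : 0 < ‖y‖ ^ 2 + originBump d y := by
  by_cases hy : y = 0
  · rw [hy, (originBump d).one_of_mem_closedBall (by simp [originBump])]
    simp
  · have : 0 < ‖y‖ := norm_pos_iff.mpr hy
    have := (originBump d).nonneg (x := y)
    positivity

theorem contDiff_radialPow (p : ℝ) : ContDiff ℝ ∞ (radialPow (d := d) p) :=
  ((contDiff_norm_sq ℝ).add (originBump d).contDiff).rpow_const_of_ne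
    fun y => (radialPow_base_pos y).ne'

theorem originBump_eq_zero {y : Eucl d} (hy : 1 / 2 ≤ ‖y‖) : originBump d y = 0 :=
  (originBump d).zero_of_le_dist (by simpa [originBump] using hy)

theorem radialPow_eq (p : ℝ) {y : Eucl d} (hy : 1 / 2 ≤ ‖y‖) : radialPow p y = ‖y‖ ^ p := by
  rw [radialPow, originBump_eq_zero hy, add_zero, ← Real.rpow_natCast, ← Real.rpow_mul (norm_nonneg _)]
  congr 1
  push_cast
  ring

/-- Euler's identity for the homogeneous function `|y|^p`. -/
theorem fderiv_radialPow_self (p : ℝ) {y : Eucl d} (hy : 1 ≤ ‖y‖) :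
    fderiv ℝ (radialPow p) y y = p * radialPow p y := by
  have h1 : HasDerivAt (fun t : ℝ => (1 + t) • y) y 0 := by
    simpa using ((hasDerivAt_id (0 : ℝ)).const_add 1).smul_const y
  have hdiff : DifferentiableAt ℝ (radialPow p) ((1 + (0 : ℝ)) • y) :=
    (contDiff_radialPow p).differentiable (by simp) _
  have h2 := hdiff.hasFDerivAt.comp_hasDerivAt (0 : ℝ) h1
  have h3 : (radialPow p ∘ fun t : ℝ => (1 + t) • y) =ᶠ[nhds 0]
      fun t : ℝ => (1 + t) ^ p * ‖y‖ ^ p := by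
    filter_upwards [Ioo_mem_nhds (show (-1 / 2 : ℝ) < 0 by norm_num) one_pos] with t ht
    have ht0 : 0 ≤ 1 + t := by linarith [ht.1]
    have hn : ‖(1 + t) • y‖ = (1 + t) * ‖y‖ := by rw [norm_smul, Real.norm_of_nonneg ht0]
    rw [Function.comp_apply, radialPow_eq p, hn, Real.mul_rpow ht0 (norm_nonneg _)]
    rw [hn]
    nlinarith [ht.1]
  have h4 : HasDerivAt (fun t : ℝ => (1 + t) ^ p * ‖y‖ ^ p) (p * ‖y‖ ^ p) 0 := by
    have := ((hasDerivAt_id (0 : ℝ)).const_add 1).rpow_const (p := p) (Or.inl (by simp))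
    simpa using this.mul_const (‖y‖ ^ p)
  have h5 := (h2.congr_of_eventuallyEq h3.symm).unique h4
  rw [add_zero, one_smul] at h5
  rw [h5, radialPow_eq p (by linarith)]

end RadialPower

namespace RealTestFunction

variable {d : ℕ}

@[ext]
theorem ext {f g : RealTestFunction d} (h : ∀ x, f x = g x) : f = g := by
  cases f; cases g; congr; exact funext h

/-- The modulated test function `y ↦ cos (s |y|^α) a(y)`. -/
def cosMod (α s : ℝ) (a : RealTestFunction d) : RealTestFunction d where
  toFun y := Real.cos (s * radialPow α y) * a y
  smooth := (Real.contDiff_cos.comp (contDiff_const.mul (contDiff_radialPow α))).mul a.smooth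
  compact := a.compact.mul_left

theorem cosMod_apply (α s : ℝ) (a : RealTestFunction d) (y : Eucl d) :
    a.cosMod α s y = Real.cos (s * radialPow α y) * a y := rfl

theorem tsupport_cosMod_subset (α s : ℝ) (a : RealTestFunction d) :
    tsupport (a.cosMod α s : Eucl d → ℝ) ⊆ tsupport (a : Eucl d → ℝ) :=
  closure_mono fun _ hy => right_ne_zero_of_mul hy

/-- Each derivative of `cos (s |y|^α) a(y)` costs at most a factor `1 + |s|`. -/
theorem exists_iteratedFDeriv_cosMod_le (α : ℝ) (a : RealTestFunction d) (n : ℕ) :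
    ∃ C, 0 ≤ C ∧ ∀ s y, ‖iteratedFDeriv ℝ n (a.cosMod α s : Eucl d → ℝ) y‖ ≤ C * (1 + |s|) ^ n := by
  have hu := contDiff_radialPow (d := d) α
  have hcont : ∀ i : ℕ, Continuous fun y => ‖iteratedFDeriv ℝ i (radialPow (d := d) α) y‖ :=
    fun i => (hu.continuous_iteratedFDeriv ENat.LEInfty.out).norm
  have hconta : ∀ i : ℕ, Continuous fun y => ‖iteratedFDeriv ℝ i (a : Eucl d → ℝ) y‖ :=
    fun i => (a.smooth.continuous_iteratedFDeriv ENat.LEInfty.out).norm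
  -- `B` dominates the derivatives of the phase on the support of `a`
  obtain ⟨B, hB⟩ : ∃ B : ℝ, ∀ i ≤ n, ∀ y ∈ tsupport (a : Eucl d → ℝ),
      ‖iteratedFDeriv ℝ i (radialPow (d := d) α) y‖ ≤ B := by
    obtain ⟨B, hB⟩ := a.compact.isCompact.exists_bound_of_continuousOn
      (f := fun y => ∑ i ∈ Finset.range (n + 1), ‖iteratedFDeriv ℝ i (radialPow (d := d) α) y‖)
      (continuous_finsetSum _ fun i _ => hcont i).continuousOn
    refine ⟨B, fun i hi y hy => ?_⟩
    refine le_trans ?_ ((le_abs_self _).trans (hB y hy))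
    exact Finset.single_le_sum (f := fun i => ‖iteratedFDeriv ℝ i (radialPow (d := d) α) y‖)
      (fun _ _ => norm_nonneg _) (Finset.mem_range.mpr (by omega))
  obtain ⟨A, hA⟩ : ∃ A : ℝ, ∀ i ≤ n, ∀ y ∈ tsupport (a : Eucl d → ℝ),
      ‖iteratedFDeriv ℝ i (a : Eucl d → ℝ) y‖ ≤ A := by
    obtain ⟨A, hA⟩ := a.compact.isCompact.exists_bound_of_continuousOn
      (f := fun y => ∑ i ∈ Finset.range (n + 1), ‖iteratedFDeriv ℝ i (a : Eucl d → ℝ) y‖)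
      (continuous_finsetSum _ fun i _ => hconta i).continuousOn
    refine ⟨A, fun i hi y hy => ?_⟩
    refine le_trans ?_ ((le_abs_self _).trans (hA y hy))
    exact Finset.single_le_sum (f := fun i => ‖iteratedFDeriv ℝ i (a : Eucl d → ℝ) y‖)
      (fun _ _ => norm_nonneg _) (Finset.mem_range.mpr (by omega))
  set B' := max B 1
  set A' := max A 0
  have hB1 : 1 ≤ B' := le_max_right _ _
  have hA0 : 0 ≤ A' := le_max_right _ _
  refine ⟨∑ i ∈ Finset.range (n + 1), (n.choose i : ℝ) * (i.factorial * 1 * B' ^ i) * A',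
    by positivity, fun s y => ?_⟩
  by_cases hy : y ∈ tsupport (a : Eucl d → ℝ)
  swap
  · have : iteratedFDeriv ℝ n (a.cosMod α s : Eucl d → ℝ) y = 0 := by
      by_contra h
      exact hy (tsupport_cosMod_subset α s a
        (support_iteratedFDeriv_subset (𝕜 := ℝ) n (Function.mem_support.mpr h)))
    rw [this, norm_zero]
    positivity
  have hs1 : 1 ≤ 1 + |s| := le_add_of_nonneg_right (abs_nonneg _)
  have hcos : ∀ i ≤ n, ‖iteratedFDeriv ℝ i (fun y => Real.cos (s * radialPow α y)) y‖ ≤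
      i.factorial * 1 * (B' * (1 + |s|)) ^ i := by
    intro i hi
    have hsu : ContDiff ℝ ∞ (fun y : Eucl d => s * radialPow α y) := contDiff_const.mul hu
    refine norm_iteratedFDeriv_comp_le (g := Real.cos) (N := ∞) Real.contDiff_cos hsu
      ENat.LEInfty.out y ?_ ?_
    · intro j _
      rw [norm_iteratedFDeriv_eq_norm_iteratedDeriv]
      exact Real.abs_iteratedDeriv_cos_le_one j _
    · intro j hj hji
      have h1 : iteratedFDeriv ℝ j (fun y : Eucl d => s * radialPow α y) y =
          s • iteratedFDeriv ℝ j (radialPow α) y :=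
        iteratedFDeriv_const_smul_apply (f := radialPow α) (a := s) (hu.contDiffAt.of_le ENat.LEInfty.out)
      rw [h1, norm_smul, Real.norm_eq_abs]
      calc |s| * ‖iteratedFDeriv ℝ j (radialPow α) y‖ ≤ (1 + |s|) * B' :=
            mul_le_mul (by linarith) ((hB j (hji.trans hi) y hy).trans (le_max_left _ _))
              (norm_nonneg _) (by positivity)
        _ = B' * (1 + |s|) := mul_comm _ _
        _ ≤ (B' * (1 + |s|)) ^ j := le_self_pow₀ (one_le_mul_of_one_le_of_one_le hB1 hs1) (by omega)
  refine (norm_iteratedFDeriv_mul_le (N := ∞)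
    (Real.contDiff_cos.comp (contDiff_const.mul hu)) a.smooth y ENat.LEInfty.out).trans ?_
  rw [Finset.sum_mul]
  refine Finset.sum_le_sum fun i hi => ?_
  have hi' : i ≤ n := by have := Finset.mem_range.mp hi; omega
  calc (n.choose i : ℝ) * ‖iteratedFDeriv ℝ i (fun y => Real.cos (s * radialPow α y)) y‖ *
        ‖iteratedFDeriv ℝ (n - i) (a : Eucl d → ℝ) y‖
      ≤ (n.choose i : ℝ) * (i.factorial * 1 * (B' * (1 + |s|)) ^ i) * A' := by
        gcongr
        · exact hcos i hi'
        · exact (hA _ (Nat.sub_le _ _) y hy).trans (le_max_left _ _)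
    _ = (n.choose i : ℝ) * (i.factorial * 1 * B' ^ i) * A' * (1 + |s|) ^ i := by
        rw [mul_pow]; ring
    _ ≤ _ := by
        gcongr

theorem abs_lap_le (f : RealTestFunction d) (y : Eucl d) :
    |f.lap y| ≤ d * ‖iteratedFDeriv ℝ 2 (f : Eucl d → ℝ) y‖ := by
  change |Δ (f : Eucl d → ℝ) y| ≤ _
  rw [InnerProductSpace.laplacian_eq_iteratedFDeriv_orthonormalBasis _
    (EuclideanSpace.basisFun (Fin d) ℝ)]
  refine (Finset.abs_sum_le_sum_abs _ _).trans ?_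
  refine (Finset.sum_le_card_nsmul _ _ ‖iteratedFDeriv ℝ 2 (f : Eucl d → ℝ) y‖ ?_).trans
    (le_of_eq (by simp))
  intro i _
  refine ((iteratedFDeriv ℝ 2 (f : Eucl d → ℝ) y).le_opNorm _).trans (le_of_eq ?_)
  simp [Fin.prod_univ_two]

theorem norm_mul_norm_iteratedFDeriv_le (f : RealTestFunction d) {r : ℝ}
    (hf : ∀ y, f y ≠ 0 → ‖y‖ ≤ r) (n : ℕ) (y : Eucl d) :
    ‖y‖ * ‖iteratedFDeriv ℝ n (f : Eucl d → ℝ) y‖ ≤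
      r * ‖iteratedFDeriv ℝ n (f : Eucl d → ℝ) y‖ := by
  by_cases h : iteratedFDeriv ℝ n (f : Eucl d → ℝ) y = 0
  · simp [h]
  · refine mul_le_mul_of_nonneg_right ?_ (norm_nonneg _)
    have h1 : y ∈ tsupport (f : Eucl d → ℝ) :=
      support_iteratedFDeriv_subset (𝕜 := ℝ) n (Function.mem_support.mpr h)
    have h2 : tsupport (f : Eucl d → ℝ) ⊆ Metric.closedBall 0 r :=
      closure_minimal (fun z hz => mem_closedBall_zero_iff.mpr (hf z hz)) Metric.isClosed_closedBall
    exact mem_closedBall_zero_iff.mp (h2 h1)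

theorem norm_fderiv_eul_le (f : RealTestFunction d) (c : ℝ) (y : Eucl d) :
    ‖fderiv ℝ (f.eul c : Eucl d → ℝ) y‖ ≤
      (|c| + 1) * ‖iteratedFDeriv ℝ 1 (f : Eucl d → ℝ) y‖ +
        ‖y‖ * ‖iteratedFDeriv ℝ 2 (f : Eucl d → ℝ) y‖ := by
  have h1 : DifferentiableAt ℝ (fderiv ℝ (f : Eucl d → ℝ)) y :=
    ((f.smooth.fderiv_right (m := ∞) (by simp)).differentiable (by simp)) y
  have h2 := ((f.differentiable y).hasFDerivAt.const_mul c).add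
    (h1.hasFDerivAt.clm_apply (hasFDerivAt_id y))
  have h3 : fderiv ℝ (f.eul c : Eucl d → ℝ) y = _ := h2.fderiv
  have e1 : ‖iteratedFDeriv ℝ 1 (f : Eucl d → ℝ) y‖ = ‖fderiv ℝ (f : Eucl d → ℝ) y‖ :=
    norm_iteratedFDeriv_one _
  have e2 : ‖iteratedFDeriv ℝ 2 (f : Eucl d → ℝ) y‖ =
      ‖fderiv ℝ (fderiv ℝ (f : Eucl d → ℝ)) y‖ := by
    rw [← norm_iteratedFDeriv_fderiv (n := 1), norm_iteratedFDeriv_one]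
  rw [h3, e1, e2]
  refine ContinuousLinearMap.opNorm_le_bound _ (by positivity) fun v => ?_
  simp only [_root_.add_apply, _root_.smul_apply, ContinuousLinearMap.comp_apply,
    ContinuousLinearMap.flip_apply, smul_eq_mul, id_eq, ContinuousLinearMap.coe_id']
  have b1 := (fderiv ℝ (f : Eucl d → ℝ) y).le_opNorm v
  have b2 : ‖(fderiv ℝ (fderiv ℝ (f : Eucl d → ℝ)) y) v y‖ ≤
      ‖fderiv ℝ (fderiv ℝ (f : Eucl d → ℝ)) y‖ * ‖v‖ * ‖y‖ :=
    (fderiv ℝ (fderiv ℝ (f : Eucl d → ℝ)) y).le_opNorm₂ v y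
  refine (norm_add_le _ _).trans ?_
  rw [norm_mul, Real.norm_eq_abs c]
  have b3 := norm_add_le ((fderiv ℝ (f : Eucl d → ℝ) y) v)
    ((fderiv ℝ (fderiv ℝ (f : Eucl d → ℝ)) y) v y)
  have b4 := mul_le_mul_of_nonneg_left b1 (abs_nonneg c)
  nlinarith

/-- The rescaled test function `x ↦ f (x / R)`. -/
def scale (R : ℝ) (f : RealTestFunction d) : RealTestFunction d := f.dil 0 (-Real.log R)

theorem scale_apply {R : ℝ} (hR : 0 < R) (f : RealTestFunction d) (x : Eucl d) :
    f.scale R x = f (R⁻¹ • x) := by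
  rw [scale, dil_apply, zero_mul, Real.exp_zero, one_mul, Real.exp_neg, Real.exp_log hR]

theorem fderiv_scale {R : ℝ} (hR : 0 < R) (f : RealTestFunction d) (x : Eucl d) :
    fderiv ℝ (f.scale R : Eucl d → ℝ) x = R⁻¹ • fderiv ℝ (f : Eucl d → ℝ) (R⁻¹ • x) := by
  have h : (f.scale R : Eucl d → ℝ) = fun x => f (R⁻¹ • x) := funext (scale_apply hR f)
  rw [h, fderiv_comp_smul]

theorem eul_scale {R : ℝ} (hR : 0 < R) (c : ℝ) (f : RealTestFunction d) :
    (f.scale R).eul c = (f.eul c).scale R := by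
  ext x
  rw [scale_apply hR, eul_apply, eul_apply, scale_apply hR, fderiv_scale hR, map_smul,
    _root_.smul_apply]

theorem lap_scale {R : ℝ} (hR : 0 < R) (f : RealTestFunction d) (x : Eucl d) :
    (f.scale R).lap x = R⁻¹ ^ 2 * f.lap (R⁻¹ • x) := by
  rw [← scale_apply hR, scale, scale, lap_dil, two_mul, Real.exp_add, Real.exp_neg,
    Real.exp_log hR, pow_two]

theorem measureReal_closedBall_mul {R r : ℝ} (hR : 0 ≤ R) (hr : 0 ≤ r) :
    volume.real (Metric.closedBall (0 : Eucl d) (R * r)) =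
      R ^ d * volume.real (Metric.closedBall (0 : Eucl d) r) := by
  have h := Measure.addHaar_closedBall_mul (volume : Measure (Eucl d)) 0 hR hr
  rw [Measure.real, h, ENNReal.toReal_mul, ENNReal.toReal_ofReal (by positivity),
    finrank_euclideanSpace_fin, Measure.real]

theorem mem_of_eul_ne_zero {f : RealTestFunction d} {K : Set (Eucl d)} (hK : IsClosed K)
    (hf : ∀ x, f x ≠ 0 → x ∈ K) {c : ℝ} {x : Eucl d} (hx : f.eul c x ≠ 0) : x ∈ K := by
  by_contra h
  have hfx : f x = 0 := by
    by_contra h'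
    exact h (hf x h')
  have h1 : x ∉ tsupport (f : Eucl d → ℝ) := fun h' => h (closure_minimal hf hK h')
  have h2 : fderiv ℝ (f : Eucl d → ℝ) x = 0 := by
    by_contra h'
    exact h1 (support_fderiv_subset ℝ (Function.mem_support.mpr h'))
  exact hx (by rw [eul_apply, hfx, h2]; simp)

theorem mem_of_lap_ne_zero {f : RealTestFunction d} {K : Set (Eucl d)} (hK : IsClosed K)
    (hf : ∀ x, f x ≠ 0 → x ∈ K) {x : Eucl d} (hx : f.lap x ≠ 0) : x ∈ K := by
  by_contra h
  have h1 : x ∉ tsupport (f : Eucl d → ℝ) := fun h' => h (closure_minimal hf hK h')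
  have h2 : iteratedFDeriv ℝ 2 (f : Eucl d → ℝ) x = 0 := by
    by_contra h'
    exact h1 (support_iteratedFDeriv_subset (𝕜 := ℝ) 2 (Function.mem_support.mpr h'))
  have := f.abs_lap_le x
  rw [h2, norm_zero, mul_zero] at this
  exact hx (abs_nonpos_iff.mp this)

theorem mem_of_fderiv_ne_zero {f : RealTestFunction d} {K : Set (Eucl d)} (hK : IsClosed K)
    (hf : ∀ x, f x ≠ 0 → x ∈ K) {x : Eucl d} (hx : fderiv ℝ (f : Eucl d → ℝ) x ≠ 0) : x ∈ K :=
  closure_minimal hf hK (support_fderiv_subset ℝ (Function.mem_support.mpr hx))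

theorem size_le (f : RealTestFunction d) {M r : ℝ} (hM : 0 ≤ M) (hf : ∀ x, f x ≠ 0 → ‖x‖ ≤ r)
    (h0 : ∀ x, |f x| ≤ M) (h2 : ∀ x, |f.lap x| ≤ M) :
    f.size ≤ 2 * M * √(volume.real (Metric.closedBall (0 : Eucl d) r)) := by
  have hK : ∀ x, f x ≠ 0 → x ∈ Metric.closedBall (0 : Eucl d) r :=
    fun x hx => mem_closedBall_zero_iff.mpr (hf x hx)
  have e1 := f.norm_toL2_le (r := r) hM (fun x => by
    by_cases hx : x ∈ Metric.closedBall (0 : Eucl d) r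
    · rw [Set.indicator_of_mem hx]; exact h0 x
    · rw [Set.indicator_of_notMem hx, abs_nonpos_iff]
      by_contra h
      exact hx (hK x h))
  have e2 := f.lap.norm_toL2_le (r := r) hM (fun x => by
    by_cases hx : x ∈ Metric.closedBall (0 : Eucl d) r
    · rw [Set.indicator_of_mem hx]; exact h2 x
    · rw [Set.indicator_of_notMem hx, abs_nonpos_iff]
      by_contra h
      exact hx (mem_of_lap_ne_zero Metric.isClosed_closedBall hK h))
  unfold size
  linarith

/-- The oscillating test function `x ↦ cos (k |x|^α) a (x / R)` (for `a` supported away from the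
origin), which resonates with the oscillations of the potential at distance `R`. -/
def osc (α k R : ℝ) (a : RealTestFunction d) : RealTestFunction d :=
  (a.cosMod α (k * R ^ α)).scale R

/-- Pointwise bounds for the oscillating test functions: a derivative costs a factor
`1 + R ^ (α - 1)`, the size of the local frequency. -/
theorem exists_osc_bounds (α k : ℝ) (a : RealTestFunction d) :
    ∃ C, 0 ≤ C ∧ ∀ R, 1 ≤ R → ∀ x,
      |a.osc α k R x| ≤ C ∧
      |(a.osc α k R).eul d x| ≤ C * (R * (1 + R ^ (α - 1))) ∧
      ‖fderiv ℝ ((a.osc α k R).eul d : Eucl d → ℝ) x‖ ≤ C * (R * (1 + R ^ (α - 1)) ^ 2) ∧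
      |(a.osc α k R).lap x| ≤ C * (1 + R ^ (α - 1)) ^ 2 := by
  obtain ⟨r, hr, hsupp⟩ := a.exists_radius
  obtain ⟨C₀, hC₀, h0⟩ := a.exists_iteratedFDeriv_cosMod_le α 0
  obtain ⟨C₁, hC₁, h1⟩ := a.exists_iteratedFDeriv_cosMod_le α 1
  obtain ⟨C₂, hC₂, h2⟩ := a.exists_iteratedFDeriv_cosMod_le α 2
  set m := 1 + |k|
  have hm : 1 ≤ m := le_add_of_nonneg_right (abs_nonneg _)
  set D := C₀ + d * C₀ + (d + 1 + r) * C₁ + (r + d) * C₂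
  have hD : 0 ≤ D := by positivity
  have hD0 : C₀ ≤ D := by
    have : 0 ≤ d * C₀ + (d + 1 + r) * C₁ + (r + d) * C₂ := by positivity
    linarith
  have hD1 : d * C₀ + r * C₁ ≤ D := by
    have : 0 ≤ C₀ + (d + 1) * C₁ + (r + d) * C₂ := by positivity
    linarith
  have hD2 : (d + 1) * C₁ + r * C₂ ≤ D := by
    have : 0 ≤ C₀ + d * C₀ + r * C₁ + d * C₂ := by positivity
    linarith
  have hD3 : d * C₂ ≤ D := by
    have : 0 ≤ C₀ + d * C₀ + (d + 1 + r) * C₁ + r * C₂ := by positivity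
    linarith
  refine ⟨D * m ^ 2, by positivity, fun R hR x => ?_⟩
  have hR0 : 0 < R := by linarith
  set l := 1 + R ^ (α - 1)
  have hl : 1 ≤ l := le_add_of_nonneg_right (Real.rpow_nonneg hR0.le _)
  set s := k * R ^ α
  -- the frequency in the scaled variable
  have hs : 1 + |s| ≤ m * (R * l) := by
    have e1 : R * R ^ (α - 1) = R ^ α := by
      rw [Real.rpow_sub_one hR0.ne', mul_div_cancel₀ _ hR0.ne']
    have e2 : |s| = |k| * R ^ α := by
      rw [abs_mul, abs_of_nonneg (Real.rpow_nonneg hR0.le _)]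
    have e3 := Real.rpow_nonneg hR0.le α
    have e4 : m * (R * l) = R + R ^ α + |k| * R + |k| * R ^ α := by
      simp only [m, l]
      rw [mul_add, e1]
      ring
    have := abs_nonneg k
    rw [e2, e4]
    nlinarith
  have hs1 : 1 ≤ 1 + |s| := le_add_of_nonneg_right (abs_nonneg _)
  set g := a.cosMod α s
  have hg : ∀ y, g y ≠ 0 → ‖y‖ ≤ r := fun y hy => hsupp y (right_ne_zero_of_mul hy)
  set y := R⁻¹ • x
  have b0 : |g y| ≤ C₀ := by
    have := h0 s y
    rwa [norm_iteratedFDeriv_zero, pow_zero, mul_one] at this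
  have b1 := h1 s y
  rw [pow_one] at b1
  have b2 := h2 s y
  have ba := g.norm_mul_norm_iteratedFDeriv_le hg 1 y
  have bb := g.norm_mul_norm_iteratedFDeriv_le hg 2 y
  have hm2 : m ≤ m ^ 2 := le_self_pow₀ hm (by norm_num)
  have heul : |g.eul d y| ≤ D * (1 + |s|) := by
    have e1 : |fderiv ℝ (g : Eucl d → ℝ) y y| ≤ r * (C₁ * (1 + |s|)) := by
      refine ((fderiv ℝ (g : Eucl d → ℝ) y).le_opNorm y).trans ?_
      rw [← norm_iteratedFDeriv_one (𝕜 := ℝ), mul_comm]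
      exact ba.trans (mul_le_mul_of_nonneg_left b1 hr.le)
    rw [eul_apply]
    refine (abs_add_le _ _).trans ?_
    rw [abs_mul, Nat.abs_cast]
    calc d * |g y| + |fderiv ℝ (g : Eucl d → ℝ) y y| ≤ d * C₀ + r * (C₁ * (1 + |s|)) := by gcongr
      _ ≤ d * C₀ * (1 + |s|) + r * (C₁ * (1 + |s|)) := by
        exact add_le_add_left (le_mul_of_one_le_right (by positivity) hs1) _
      _ = (d * C₀ + r * C₁) * (1 + |s|) := by ring
      _ ≤ _ := by gcongr
  have hfder : ‖fderiv ℝ (g.eul d : Eucl d → ℝ) y‖ ≤ D * (1 + |s|) ^ 2 := by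
    refine (g.norm_fderiv_eul_le d y).trans ?_
    rw [Nat.abs_cast]
    calc _ ≤ (d + 1) * (C₁ * (1 + |s|)) + r * (C₂ * (1 + |s|) ^ 2) := by
          exact add_le_add (mul_le_mul_of_nonneg_left b1 (by positivity))
            (bb.trans (mul_le_mul_of_nonneg_left b2 hr.le))
      _ ≤ (d + 1) * (C₁ * (1 + |s|) ^ 2) + r * (C₂ * (1 + |s|) ^ 2) := by
          gcongr
          exact le_self_pow₀ hs1 (by norm_num)
      _ = ((d + 1) * C₁ + r * C₂) * (1 + |s|) ^ 2 := by ring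
      _ ≤ _ := by gcongr
  have hlap : |g.lap y| ≤ D * (1 + |s|) ^ 2 := by
    refine (g.abs_lap_le y).trans ?_
    calc _ ≤ d * (C₂ * (1 + |s|) ^ 2) := by gcongr
      _ = d * C₂ * (1 + |s|) ^ 2 := by ring
      _ ≤ _ := by gcongr
  have hs2 : (1 + |s|) ^ 2 ≤ m ^ 2 * (R ^ 2 * l ^ 2) := by
    calc _ ≤ (m * (R * l)) ^ 2 := by gcongr
      _ = _ := by ring
  refine ⟨?_, ?_, ?_, ?_⟩
  · rw [osc, scale_apply hR0]
    exact (b0.trans hD0).trans (le_mul_of_one_le_right hD (one_le_pow₀ hm))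
  · rw [osc, eul_scale hR0, scale_apply hR0]
    refine heul.trans ?_
    calc D * (1 + |s|) ≤ D * (m * (R * l)) := by gcongr
      _ ≤ D * (m ^ 2 * (R * l)) := by gcongr
      _ = _ := by ring
  · rw [osc, eul_scale hR0, fderiv_scale hR0, norm_smul, Real.norm_of_nonneg (by positivity)]
    calc R⁻¹ * ‖fderiv ℝ (g.eul d : Eucl d → ℝ) y‖ ≤ R⁻¹ * (D * (m ^ 2 * (R ^ 2 * l ^ 2))) := by
          gcongr
          exact hfder.trans (by gcongr)
      _ = _ := by field_simp
  · rw [osc, lap_scale hR0, abs_mul, abs_of_nonneg (by positivity)]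
    calc R⁻¹ ^ 2 * |g.lap y| ≤ R⁻¹ ^ 2 * (D * (m ^ 2 * (R ^ 2 * l ^ 2))) := by
          gcongr
          exact hlap.trans (by gcongr)
      _ = _ := by field_simp

theorem norm_mem_of_scale_ne_zero {a : RealTestFunction d} {r₁ r₂ R : ℝ} (hR : 0 < R)
    (ha : ∀ y, a y ≠ 0 → r₁ ≤ ‖y‖ ∧ ‖y‖ ≤ r₂) {x : Eucl d} (hx : a.scale R x ≠ 0) :
    R * r₁ ≤ ‖x‖ ∧ ‖x‖ ≤ R * r₂ := by
  rw [scale_apply hR] at hx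
  have h := ha _ hx
  rw [norm_smul, Real.norm_of_nonneg (by positivity), le_inv_mul_iff₀ hR,
    inv_mul_le_iff₀ hR] at h
  exact h

theorem norm_mem_of_osc_ne_zero {a : RealTestFunction d} {r₁ r₂ α k R : ℝ} (hR : 0 < R)
    (ha : ∀ y, a y ≠ 0 → r₁ ≤ ‖y‖ ∧ ‖y‖ ≤ r₂) {x : Eucl d} (hx : a.osc α k R x ≠ 0) :
    R * r₁ ≤ ‖x‖ ∧ ‖x‖ ≤ R * r₂ :=
  norm_mem_of_scale_ne_zero hR (fun y hy => ha y (right_ne_zero_of_mul hy)) hx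

theorem exists_size_mul_size_le (α k : ℝ) (a : RealTestFunction d) :
    ∃ C, 0 ≤ C ∧ ∀ R, 1 ≤ R →
      (a.scale R).size * (a.osc α k R).size ≤ C * (R ^ d * (1 + R ^ (α - 1)) ^ 2) := by
  obtain ⟨r, hr, hsupp⟩ := a.exists_radius
  obtain ⟨C, hC, hosc⟩ := a.exists_osc_bounds α k
  obtain ⟨A, hA, hAb⟩ := a.exists_bound
  obtain ⟨B, hB, hBb⟩ := a.lap.exists_bound
  set v := volume.real (Metric.closedBall (0 : Eucl d) r)
  have hv : 0 ≤ v := measureReal_nonneg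
  refine ⟨4 * (A + B) * C * v, by positivity, fun R hR => ?_⟩
  have hR0 : 0 < R := by linarith
  have hs : ∀ y, a y ≠ 0 → 0 ≤ ‖y‖ ∧ ‖y‖ ≤ r := fun y hy => ⟨norm_nonneg _, hsupp y hy⟩
  set l := 1 + R ^ (α - 1)
  have hl : 1 ≤ l := le_add_of_nonneg_right (Real.rpow_nonneg hR0.le _)
  have h1 := (a.scale R).size_le (M := A + B) (r := R * r) (by positivity)
    (fun x hx => (norm_mem_of_scale_ne_zero hR0 hs hx).2)
    (fun x => by
      rw [scale_apply hR0]
      exact (hAb _).trans (by linarith))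
    (fun x => by
      rw [lap_scale hR0, abs_mul, abs_of_nonneg (by positivity)]
      refine (mul_le_of_le_one_left (abs_nonneg _) ?_).trans ((hBb _).trans (by linarith))
      exact pow_le_one₀ (by positivity) (inv_le_one_of_one_le₀ hR))
  have h2 := (a.osc α k R).size_le (M := C * l ^ 2) (r := R * r) (by positivity)
    (fun x hx => (norm_mem_of_osc_ne_zero hR0 hs hx).2)
    (fun x => (hosc R hR x).1.trans (le_mul_of_one_le_right hC (one_le_pow₀ hl)))
    (fun x => (hosc R hR x).2.2.2)
  have hvol : √(volume.real (Metric.closedBall (0 : Eucl d) (R * r))) *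
      √(volume.real (Metric.closedBall (0 : Eucl d) (R * r))) = R ^ d * v := by
    rw [Real.mul_self_sqrt measureReal_nonneg, measureReal_closedBall_mul hR0.le hr.le]
  calc _ ≤ _ := mul_le_mul h1 h2 (size_nonneg _) (by positivity)
    _ = 4 * (A + B) * C * l ^ 2 * (√(volume.real (Metric.closedBall (0 : Eucl d) (R * r))) *
      √(volume.real (Metric.closedBall (0 : Eucl d) (R * r)))) := by ring
    _ = _ := by rw [hvol]; ring

theorem scale_mul_osc {R : ℝ} (hR : 0 < R) (α k : ℝ) (a : RealTestFunction d) :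
    (a.scale R).mul (a.osc α k R) = (a.mul a).osc α k R := by
  ext x
  rw [mul_apply, osc, osc, scale_apply hR, scale_apply hR, scale_apply hR, cosMod_apply,
    cosMod_apply, mul_apply]
  ring

end RealTestFunction

/-! ### Resonance with the oscillating potential -/

namespace RealTestFunction

variable {d : ℕ}

theorem exists_annulus_bump (hd : 0 < d) :
    ∃ φ : RealTestFunction d, (∀ y, φ y ≠ 0 → 1 ≤ ‖y‖ ∧ ‖y‖ ≤ 2) ∧ 0 < ∫ y, φ.mul φ y := by
  set c : Eucl d := EuclideanSpace.single ⟨0, hd⟩ (3 / 2)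
  have hc : ‖c‖ = 3 / 2 := by simp [c]
  let b : ContDiffBump c := ⟨1 / 4, 1 / 2, by norm_num, by norm_num⟩
  let φ : RealTestFunction d := ⟨b, b.contDiff, b.hasCompactSupport⟩
  refine ⟨φ, fun y hy => ?_, ?_⟩
  · have h1 : y ∈ Function.support (b : Eucl d → ℝ) := hy
    rw [b.support_eq, mem_ball_iff_norm] at h1
    change ‖y - c‖ < 1 / 2 at h1
    have h2 := norm_sub_norm_le y c
    have h3 := norm_sub_norm_le c y
    rw [norm_sub_rev] at h3
    constructor <;> linarith
  · refine (φ.mul φ).continuous.integral_pos_of_hasCompactSupport_nonneg_nonzero (x := c)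
      (φ.mul φ).compact (fun y => mul_self_nonneg _) ?_
    have : φ c = 1 := b.one_of_mem_closedBall (by simp [b])
    simp [mul_apply, this]

theorem integrable (f : RealTestFunction d) : Integrable f volume :=
  f.continuous.integrable_of_hasCompactSupport f.compact

theorem integrable_continuous_mul (f : RealTestFunction d) {h : Eucl d → ℝ} (hh : Continuous h) :
    Integrable (fun y => h y * f y) volume :=
  (hh.mul f.continuous).integrable_of_hasCompactSupport f.compact.mul_left

/-- Integration by parts along the Euler field: the derivative of the oscillating factor of the
potential is `cos`, which resonates with the modulation of the test function. -/
theorem integral_sin_mul_eul (α β s : ℝ) (a : RealTestFunction d)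
    (ha : ∀ y, a y ≠ 0 → 1 ≤ ‖y‖) :
    ∫ y, radialPow (-β) y * Real.sin (s * radialPow α y) * (a.cosMod α s).eul d y =
      (∫ y, β * (radialPow (-β) y * Real.sin (s * radialPow α y) *
          Real.cos (s * radialPow α y)) * a y) -
        ∫ y, s * α * (radialPow (-β) y * radialPow α y *
          Real.cos (s * radialPow α y) ^ 2) * a y := by
  have hu := contDiff_radialPow (d := d) α
  have hb := contDiff_radialPow (d := d) (-β)
  have hsu : ContDiff ℝ ∞ fun y : Eucl d => s * radialPow α y := contDiff_const.mul hu
  have hsin : ContDiff ℝ ∞ fun y : Eucl d => Real.sin (s * radialPow α y) :=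
    Real.contDiff_sin.comp hsu
  have hcos : ContDiff ℝ ∞ fun y : Eucl d => Real.cos (s * radialPow α y) :=
    Real.contDiff_cos.comp hsu
  set S : Eucl d → ℝ := fun y => radialPow (-β) y * Real.sin (s * radialPow α y) with hSdef
  have hS : ContDiff ℝ ∞ S := hb.mul hsin
  set g := a.cosMod α s
  let P : RealTestFunction d := ⟨fun y => S y * g y, hS.mul g.smooth, g.compact.mul_left⟩
  have hPe : ∀ y, P.eul d y = S y * g.eul d y + fderiv ℝ S y y * g y := by
    intro y
    have h : fderiv ℝ (P : Eucl d → ℝ) y = S y • fderiv ℝ g y + g y • fderiv ℝ S y :=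
      fderiv_fun_mul (hS.differentiable (by simp) y) (g.differentiable y)
    rw [eul_apply, eul_apply, h]
    simp only [P, _root_.add_apply, _root_.smul_apply, smul_eq_mul]
    ring
  have hSd : ∀ y : Eucl d, 1 ≤ ‖y‖ → fderiv ℝ S y y =
      -β * (radialPow (-β) y * Real.sin (s * radialPow α y)) +
        s * α * (radialPow (-β) y * radialPow α y * Real.cos (s * radialPow α y)) := by
    intro y hy
    have h1 := (hu.differentiable (by simp) y).hasFDerivAt
    have h2 := (hb.differentiable (by simp) y).hasFDerivAt
    have h3 := h2.mul (h1.const_mul s).sin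
    have h4 : fderiv ℝ S y = _ := h3.fderiv
    rw [h4]
    simp only [_root_.add_apply, _root_.smul_apply, smul_eq_mul, fderiv_radialPow_self _ hy]
    ring
  have hpt : ∀ y, S y * g.eul d y = P.eul d y +
      (β * (radialPow (-β) y * Real.sin (s * radialPow α y) *
          Real.cos (s * radialPow α y)) * a y -
        s * α * (radialPow (-β) y * radialPow α y *
          Real.cos (s * radialPow α y) ^ 2) * a y) := by
    intro y
    rw [hPe]
    have hgy : g y = Real.cos (s * radialPow α y) * a y := rfl
    by_cases hy : a y = 0
    · rw [hgy, hy]; ring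
    · rw [hSd y (ha y hy), hgy]; ring
  have i1 : Integrable (fun y => β * (radialPow (-β) y * Real.sin (s * radialPow α y) *
      Real.cos (s * radialPow α y)) * a y) volume :=
    a.integrable_continuous_mul
      (continuous_const.mul ((hb.continuous.mul hsin.continuous).mul hcos.continuous))
  have i2 : Integrable (fun y => s * α * (radialPow (-β) y * radialPow α y *
      Real.cos (s * radialPow α y) ^ 2) * a y) volume :=
    a.integrable_continuous_mul
      (continuous_const.mul ((hb.continuous.mul hu.continuous).mul (hcos.continuous.pow 2)))
  rw [← integral_sub i1 i2]
  calc ∫ y, S y * g.eul d y = ∫ y, (P.eul d y +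
      (β * (radialPow (-β) y * Real.sin (s * radialPow α y) *
          Real.cos (s * radialPow α y)) * a y -
        s * α * (radialPow (-β) y * radialPow α y *
          Real.cos (s * radialPow α y) ^ 2) * a y)) := integral_congr_ae (.of_forall hpt)
    _ = _ := by
      have i12 := i1.sub i2
      simp only [Pi.sub_def] at i12
      rw [integral_add (P.eul d).integrable i12, P.integral_eul, zero_add]

/-- The resonant integral `∫ cos² (s |y|^α) a(y) dy`. -/
def cosSqIntegral (α s : ℝ) (a : RealTestFunction d) : ℝ :=
  ∫ y, Real.cos (s * radialPow α y) ^ 2 * a y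

theorem integrable_cosSq (α s : ℝ) (a : RealTestFunction d) :
    Integrable (fun y => Real.cos (s * radialPow α y) ^ 2 * a y) volume :=
  a.integrable_continuous_mul ((Real.continuous_cos.comp
    (continuous_const.mul (contDiff_radialPow α).continuous)).pow 2)

/-- The resonant integral cannot be small at both frequencies `s` and `2 s`, because
`cos² (2 θ) ≥ 1 - 4 cos² θ`. -/
theorem integral_le_cosSqIntegral (α s : ℝ) (a : RealTestFunction d) (ha : ∀ y, 0 ≤ a y) :
    ∫ y, a y ≤ a.cosSqIntegral α (2 * s) + 4 * a.cosSqIntegral α s := by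
  unfold cosSqIntegral
  rw [← integral_const_mul, ← integral_add (a.integrable_cosSq α (2 * s))
    ((a.integrable_cosSq α s).const_mul 4)]
  refine integral_mono a.integrable ((a.integrable_cosSq α (2 * s)).add
    ((a.integrable_cosSq α s).const_mul 4)) fun y => ?_
  have h : Real.cos (2 * s * radialPow α y) = 2 * Real.cos (s * radialPow α y) ^ 2 - 1 := by
    rw [mul_assoc, Real.cos_two_mul]
  simp only [h]
  nlinarith [ha y, mul_nonneg (sq_nonneg (Real.cos (s * radialPow α y) ^ 2)) (ha y)]

/-- The resonant integral is controlled by the Euler derivative tested against the oscillating factor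
`sin`; the decay `|y|^(-β)` is harmless because `β ≤ α` and `|y| ≥ 1` on the support of `a`. -/
theorem cosSqIntegral_le {α β : ℝ} (hα : 0 ≤ α) (hβ : 0 ≤ β) (hαβ : β ≤ α) (s : ℝ)
    (a : RealTestFunction d) (ha : ∀ y, 0 ≤ a y) (ha1 : ∀ y, a y ≠ 0 → 1 ≤ ‖y‖) :
    |s| * α * a.cosSqIntegral α s ≤
      |∫ y, radialPow (-β) y * Real.sin (s * radialPow α y) * (a.cosMod α s).eul d y| +
        β * ∫ y, a y := by
  have hu := (contDiff_radialPow (d := d) α).continuous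
  have hb := (contDiff_radialPow (d := d) (-β)).continuous
  have hcos : Continuous fun y : Eucl d => Real.cos (s * radialPow α y) :=
    Real.continuous_cos.comp (continuous_const.mul hu)
  have h := a.integral_sin_mul_eul α β s ha1
  set X := ∫ y, radialPow (-β) y * Real.sin (s * radialPow α y) * (a.cosMod α s).eul d y
  have hpow : ∀ (y : Eucl d) (p : ℝ), 0 ≤ radialPow p y :=
    fun y p => Real.rpow_nonneg (radialPow_base_pos y).le _
  have h1 : |∫ y, β * (radialPow (-β) y * Real.sin (s * radialPow α y) *
      Real.cos (s * radialPow α y)) * a y| ≤ β * ∫ y, a y := by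
    rw [← integral_const_mul, ← Real.norm_eq_abs]
    refine norm_integral_le_of_norm_le (a.integrable.const_mul β) (.of_forall fun y => ?_)
    by_cases hy : a y = 0
    · simp [hy]
    have e1 : radialPow (-β) y ≤ 1 := by
      rw [radialPow_eq _ (by linarith [ha1 y hy])]
      exact Real.rpow_le_one_of_one_le_of_nonpos (ha1 y hy) (by linarith)
    rw [Real.norm_eq_abs, abs_mul, abs_mul, abs_mul, abs_mul, abs_of_nonneg hβ,
      abs_of_nonneg (ha y), abs_of_nonneg (hpow y _)]
    have e2 := Real.abs_sin_le_one (s * radialPow α y)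
    have e3 := Real.abs_cos_le_one (s * radialPow α y)
    have e4 : radialPow (-β) y * |Real.sin (s * radialPow α y)| * |Real.cos (s * radialPow α y)| ≤ 1 :=
      mul_le_one₀ (mul_le_one₀ e1 (abs_nonneg _) e2) (abs_nonneg _) e3
    exact mul_le_mul_of_nonneg_right (mul_le_of_le_one_right hβ e4) (ha y)
  have h2 : a.cosSqIntegral α s ≤ ∫ y, radialPow (-β) y * radialPow α y *
      Real.cos (s * radialPow α y) ^ 2 * a y := by
    refine integral_mono (a.integrable_cosSq α s)
      (a.integrable_continuous_mul ((hb.mul hu).mul (hcos.pow 2))) fun y => ?_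
    by_cases hy : a y = 0
    · simp [hy]
    have hy1 := ha1 y hy
    have e1 : 1 ≤ radialPow (-β) y * radialPow α y := by
      rw [radialPow_eq _ (by linarith), radialPow_eq _ (by linarith),
        ← Real.rpow_add (by linarith)]
      exact Real.one_le_rpow hy1 (by linarith)
    exact mul_le_mul_of_nonneg_right (le_mul_of_one_le_left (sq_nonneg _) e1) (ha y)
  have h3 : ∫ y, s * α * (radialPow (-β) y * radialPow α y *
      Real.cos (s * radialPow α y) ^ 2) * a y =
      s * α * ∫ y, radialPow (-β) y * radialPow α y * Real.cos (s * radialPow α y) ^ 2 * a y := by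
    rw [← integral_const_mul]
    congr 1
    ext y
    ring
  set Y := ∫ y, radialPow (-β) y * radialPow α y * Real.cos (s * radialPow α y) ^ 2 * a y
  have hY : 0 ≤ Y := integral_nonneg fun y =>
    mul_nonneg (mul_nonneg (mul_nonneg (hpow y _) (hpow y _)) (sq_nonneg _)) (ha y)
  rw [h3] at h
  have h4 : |s| * α * Y = |s * α * Y| := by
    rw [abs_mul, abs_mul, abs_of_nonneg hα, abs_of_nonneg hY]
  calc |s| * α * a.cosSqIntegral α s ≤ |s| * α * Y := by gcongr
    _ = |s * α * Y| := h4
    _ = |(∫ y, β * (radialPow (-β) y * Real.sin (s * radialPow α y) *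
      Real.cos (s * radialPow α y)) * a y) - X| := by rw [h]; ring_nf
    _ ≤ |∫ y, β * (radialPow (-β) y * Real.sin (s * radialPow α y) *
      Real.cos (s * radialPow α y)) * a y| + |X| := abs_sub _ _
    _ ≤ _ := by linarith

/-- Beyond the support of the cut-off `κ` the potential is homogeneous up to a change of frequency, so
that its integral against an oscillating test function reduces to the scaled variable `x / R`. -/
theorem integral_oscPotential_mul_eul {α β w k R : ℝ} {κ : ℝ → ℝ} (hR : 0 < R)
    (hκ : ∀ t, R ≤ t → κ t = 0) (a : RealTestFunction d) (ha : ∀ y, a y ≠ 0 → 1 ≤ ‖y‖) :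
    ∫ x, oscPotential w k α β κ x * (a.osc α k R).eul d x =
      R ^ d * (w * R ^ (-β) * ∫ y, radialPow (-β) y * Real.sin (k * R ^ α * radialPow α y) *
        (a.cosMod α (k * R ^ α)).eul d y) := by
  set g := a.cosMod α (k * R ^ α)
  have hK : IsClosed {y : Eucl d | 1 ≤ ‖y‖} := isClosed_le continuous_const continuous_norm
  have hg : ∀ y, g.eul d y ≠ 0 → 1 ≤ ‖y‖ := fun y hy =>
    mem_of_eul_ne_zero hK (fun z hz => ha z (right_ne_zero_of_mul hz)) hy
  set h : Eucl d → ℝ := fun y =>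
    w * R ^ (-β) * (radialPow (-β) y * Real.sin (k * R ^ α * radialPow α y) * g.eul d y)
  have hpt : ∀ x, oscPotential w k α β κ x * (a.osc α k R).eul d x = h (R⁻¹ • x) := by
    intro x
    have hosc : (a.osc α k R).eul d x = g.eul d (R⁻¹ • x) := by
      rw [osc, eul_scale hR, scale_apply hR]
    simp only [h]
    rw [hosc]
    by_cases h0 : g.eul d (R⁻¹ • x) = 0
    · rw [h0]; ring
    have h1 := hg _ h0
    have hn : ‖x‖ = R * ‖R⁻¹ • x‖ := by
      rw [norm_smul, Real.norm_of_nonneg (by positivity), mul_inv_cancel_left₀ hR.ne']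
    have hx : R ≤ ‖x‖ := by rw [hn]; exact le_mul_of_one_le_right hR.le h1
    rw [oscPotential, hκ _ hx, radialPow_eq _ (by linarith), radialPow_eq _ (by linarith), hn,
      Real.mul_rpow hR.le (norm_nonneg _), Real.mul_rpow hR.le (norm_nonneg _)]
    ring_nf
  rw [integral_congr_ae (.of_forall hpt),
    Measure.integral_comp_inv_smul_of_nonneg volume h hR.le, integral_const_mul,
    finrank_euclideanSpace_fin, smul_eq_mul]

end RealTestFunction

section Resonance

variable {d : ℕ}

open RealTestFunction Filter Topology

/-- The growth `R ^ α` of `x·∇W`, up to the decay `R ^ (-β)`, beats the square of the local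
frequency `1 + R ^ (α - 1)`: this is where `|α - 1| + β < 1` is used. -/
theorem tendsto_frequency_ratio {α β : ℝ} (hαβ : |α - 1| + β < 1) (hα : 0 < α)
    (c₁ c₂ : ℝ) :
    Tendsto (fun R : ℝ => (c₁ * (R ^ β * (1 + R ^ (α - 1)) ^ 2) + c₂) / R ^ α) atTop (𝓝 0) := by
  have h1 := le_abs_self (α - 1)
  have h2 := neg_abs_le (α - 1)
  have t1 := tendsto_rpow_neg_atTop (y := α - β) (by linarith)
  have t2 := tendsto_rpow_neg_atTop (y := 1 - β) (by linarith [abs_nonneg (α - 1)])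
  have t3 := tendsto_rpow_neg_atTop (y := 2 - α - β) (by linarith)
  have t4 := tendsto_rpow_neg_atTop hα
  have t := (((t1.add (t2.const_mul 2)).add t3).const_mul c₁).add (t4.const_mul c₂)
  simp only [mul_zero, add_zero] at t
  refine t.congr' ?_
  filter_upwards [eventually_gt_atTop 0] with R hR
  have e1 : R ^ (-(α - β)) = R ^ β * R ^ (-α) := by
    rw [← Real.rpow_add hR]; ring_nf
  have e2 : R ^ (-(1 - β)) = R ^ β * R ^ (α - 1) * R ^ (-α) := by
    rw [← Real.rpow_add hR, ← Real.rpow_add hR]; ring_nf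
  have e3 : R ^ (-(2 - α - β)) = R ^ β * (R ^ (α - 1) * R ^ (α - 1)) * R ^ (-α) := by
    rw [← Real.rpow_add hR, ← Real.rpow_add hR, ← Real.rpow_add hR]; ring_nf
  rw [e1, e2, e3, div_eq_mul_inv, ← Real.rpow_neg hR.le]
  ring

/-- On the oscillating test functions, the distribution `x·∇W` is not bounded by the product of
`H²` norms. -/
theorem not_exists_resonance_bound {α β w k : ℝ} (hα : 0 < α) (hβ : 0 < β) (hw : w ≠ 0) (hk : k ≠ 0)
    (hαβ : |α - 1| + β < 1) {κ : ℝ → ℝ} (hκ : HasCompactSupport κ) (a : RealTestFunction d)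
    (ha : ∀ y, 0 ≤ a y) (ha1 : ∀ y, a y ≠ 0 → 1 ≤ ‖y‖) (hpos : 0 < ∫ y, a y) {K R₀ : ℝ}
    (hK : ∀ R, R₀ ≤ R → |∫ x, oscPotential w k α β κ x * (a.osc α k R).eul d x| ≤
      K * (R ^ d * (1 + R ^ (α - 1)) ^ 2)) : False := by
  obtain ⟨Rκ, hRκ⟩ := hκ.isCompact.isBounded.subset_closedBall 0
  have hκ0 : ∀ t, max Rκ 0 + 1 ≤ t → κ t = 0 := by
    intro t ht
    by_contra h
    have h1 := hRκ (subset_tsupport _ h)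
    rw [mem_closedBall_zero_iff, Real.norm_eq_abs] at h1
    linarith [le_abs_self t, le_max_left Rκ 0]
  set J := ∫ y, a y
  set E : ℝ → ℝ := fun R => ((K / (|w| * |k| * α)) * (R ^ β * (1 + R ^ (α - 1)) ^ 2) +
    β * J / (|k| * α)) / R ^ α with hE
  have hw' : 0 < |w| := abs_pos.mpr hw
  have hk' : 0 < |k| := abs_pos.mpr hk
  have hβα : β ≤ α := by linarith [neg_abs_le (α - 1)]
  have hI : ∀ R, max R₀ (max Rκ 0 + 1) ≤ R → a.cosSqIntegral α (k * R ^ α) ≤ E R := by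
    intro R hR
    have hR1 : max Rκ 0 + 1 ≤ R := (le_max_right _ _).trans hR
    have hR0 : 0 < R := by linarith [le_max_right Rκ 0]
    have h1 := hK R ((le_max_left _ _).trans hR)
    rw [integral_oscPotential_mul_eul hR0 (fun t ht => hκ0 t (hR1.trans ht)) a ha1] at h1
    have h2 := a.cosSqIntegral_le hα.le hβ.le hβα (k * R ^ α) ha ha1
    set X := ∫ y, radialPow (-β) y * Real.sin (k * R ^ α * radialPow α y) *
        (a.cosMod α (k * R ^ α)).eul d y
    have hRα : 0 < R ^ α := Real.rpow_pos_of_pos hR0 _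
    have hRβ : 0 < R ^ β := Real.rpow_pos_of_pos hR0 _
    rw [abs_mul, abs_mul, abs_mul, abs_of_pos (pow_pos hR0 d), Real.rpow_neg hR0.le,
      abs_of_pos (inv_pos.mpr hRβ), mul_left_comm K,
      mul_le_mul_iff_right₀ (pow_pos hR0 d)] at h1
    have h3 : |X| ≤ K / |w| * (R ^ β * (1 + R ^ (α - 1)) ^ 2) := by
      have : |X| = |w| * (R ^ β)⁻¹ * |X| * (R ^ β / |w|) := by field_simp
      rw [this]
      calc _ ≤ K * (1 + R ^ (α - 1)) ^ 2 * (R ^ β / |w|) := by gcongr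
        _ = _ := by ring
    rw [abs_mul, abs_of_pos hRα] at h2
    change _ ≤ |X| + β * J at h2
    rw [hE]
    simp only
    rw [le_div_iff₀ hRα]
    have h4 : a.cosSqIntegral α (k * R ^ α) * R ^ α =
        |k| * R ^ α * α * a.cosSqIntegral α (k * R ^ α) / (|k| * α) := by field_simp
    rw [h4, div_le_iff₀ (by positivity)]
    refine h2.trans ((add_le_add_left h3 _).trans (le_of_eq ?_))
    field_simp
  -- replacing `R` by `q R` doubles the frequency `k R ^ α`
  set q : ℝ := 2 ^ (1 / α)
  have hq : 0 < q := by positivity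
  have hqα : q ^ α = 2 := by
    rw [← Real.rpow_mul (by norm_num), one_div_mul_cancel hα.ne', Real.rpow_one]
  have hE0 : Tendsto E atTop (𝓝 0) := tendsto_frequency_ratio hαβ hα _ _
  have hqt : Tendsto (fun R : ℝ => q * R) atTop atTop := tendsto_id.const_mul_atTop hq
  have hlim : Tendsto (fun R => E (q * R) + 4 * E R) atTop (𝓝 0) := by
    simpa using (hE0.comp hqt).add (hE0.const_mul 4)
  have hJ : J ≤ 0 := by
    refine ge_of_tendsto hlim ?_
    filter_upwards [eventually_ge_atTop (max R₀ (max Rκ 0 + 1)),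
      hqt.eventually_ge_atTop (max R₀ (max Rκ 0 + 1)), eventually_gt_atTop 0] with R h1 h2 h3
    have h4 := a.integral_le_cosSqIntegral α (k * R ^ α) ha
    have h5 := hI _ h2
    have h6 : k * (q * R) ^ α = 2 * (k * R ^ α) := by
      rw [Real.mul_rpow hq.le h3.le, hqα]; ring
    rw [h6] at h5
    linarith [hI _ h1]
  linarith

end Resonance

/-! ### Short-range and long-range potentials -/

section Range

variable {d : ℕ}

open RealTestFunction

theorem one_le_bracket (x : Eucl d) : 1 ≤ bracket x :=
  Real.one_le_sqrt.mpr (le_add_of_nonneg_right (sq_nonneg _))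

theorem norm_le_bracket (x : Eucl d) : ‖x‖ ≤ bracket x :=
  Real.le_sqrt_of_sq_le (by linarith)

theorem WeightedBounded.exists_le {s : ℝ} {F : Eucl d → ℝ} (hF : WeightedBounded s F) :
    ∃ C, 0 ≤ C ∧ ∀ᵐ x, |F x| ≤ C * bracket x ^ (-s) := by
  obtain ⟨C, hC⟩ := hF.2
  refine ⟨max C 0, le_max_right _ _, ?_⟩
  filter_upwards [hC] with x hx
  have hb : 0 < bracket x := by linarith [one_le_bracket x]
  have hp := Real.rpow_pos_of_pos hb s
  rw [abs_mul, abs_of_pos hp] at hx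
  rw [Real.rpow_neg hb.le, ← div_eq_mul_inv, le_div_iff₀ hp, mul_comm]
  exact hx.trans (le_max_left _ _)

theorem WeightedBounded.exists_bound {s : ℝ} {F : Eucl d → ℝ} (hF : WeightedBounded s F)
    (hs : 0 ≤ s) : ∃ C, 0 ≤ C ∧ ∀ᵐ x, |F x| ≤ C := by
  obtain ⟨C, hC0, hC⟩ := hF.exists_le
  refine ⟨C, hC0, ?_⟩
  filter_upwards [hC] with x hx
  exact hx.trans (mul_le_of_le_one_right hC0
    (Real.rpow_le_one_of_one_le_of_nonpos (one_le_bracket x) (by linarith)))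

theorem bracket_rpow_neg_le {s R : ℝ} (hs : 1 ≤ s) (hR : 0 < R) {x : Eucl d} (hx : R ≤ ‖x‖) :
    bracket x ^ (-s) ≤ R⁻¹ := by
  have h := one_le_bracket x
  calc bracket x ^ (-s) ≤ bracket x ^ (-1 : ℝ) :=
        Real.rpow_le_rpow_of_exponent_le h (by linarith)
    _ = (bracket x)⁻¹ := Real.rpow_neg_one _
    _ ≤ R⁻¹ := inv_anti₀ hR (hx.trans (norm_le_bracket x))

theorem divergence_id (x : Eucl d) : divergence (fun x : Eucl d => x) x = d := by
  simp [divergence]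

theorem abs_divergence_le {v : Eucl d → Eucl d} {C : ℝ} {x : Eucl d} (h : ‖fderiv ℝ v x‖ ≤ C) :
    |divergence v x| ≤ d * C := by
  refine (Finset.abs_sum_le_sum_abs _ _).trans ?_
  refine (Finset.sum_le_card_nsmul _ _ C fun i _ => ?_).trans (le_of_eq (by simp))
  refine (PiLp.norm_apply_le (fderiv ℝ v x (EuclideanSpace.single i 1)) i).trans ?_
  refine ((fderiv ℝ v x).le_opNorm _).trans ?_
  simpa using h

/-- An integral over the annulus `R ≤ |x| ≤ 2 R`, whose volume is of order `R ^ d`. -/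
theorem abs_integral_annulus_le {h : Eucl d → ℝ} {R M : ℝ} (hR : 0 < R) (hM : 0 ≤ M)
    (hsupp : ∀ x, h x ≠ 0 → R ≤ ‖x‖ ∧ ‖x‖ ≤ R * 2) (hb : ∀ᵐ x, R ≤ ‖x‖ → |h x| ≤ M) :
    |∫ x, h x| ≤ M * volume.real (Metric.closedBall (0 : Eucl d) 2) * R ^ d := by
  refine (abs_integral_le_of_ae_le_indicator (h := h) (M := M) (r := R * 2) ?_).trans (le_of_eq ?_)
  · filter_upwards [hb] with x hx
    by_cases hx0 : h x = 0
    · rw [hx0, abs_zero]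
      exact Set.indicator_nonneg (fun _ _ => hM) x
    · rw [Set.indicator_of_mem (mem_closedBall_zero_iff.mpr (hsupp x hx0).2)]
      exact hx (hsupp x hx0).1
  · rw [measureReal_closedBall_mul hR.le zero_le_two]
    ring

theorem isClosed_annulus (r₁ r₂ : ℝ) : IsClosed {x : Eucl d | r₁ ≤ ‖x‖ ∧ ‖x‖ ≤ r₂} :=
  (isClosed_le continuous_const continuous_norm).inter (isClosed_le continuous_norm continuous_const)


theorem norm_mem_annulus_of_osc_ne_zero {a : RealTestFunction d} {α k R : ℝ} (hR : 0 < R)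
    (ha : ∀ y, a y ≠ 0 → 1 ≤ ‖y‖ ∧ ‖y‖ ≤ 2) (x : Eucl d) (hx : a.osc α k R x ≠ 0) :
    R ≤ ‖x‖ ∧ ‖x‖ ≤ R * 2 := by
  simpa using norm_mem_of_osc_ne_zero hR ha hx

/-- A short-range potential is bounded, as a form, on the oscillating test functions: its decay
compensates the factor `x` of the Euler field. -/
theorem WeightedBounded.exists_short_range_bound {s : ℝ} {F : Eucl d → ℝ} (hF : WeightedBounded s F)
    (hs : 1 ≤ s) (α k : ℝ) (a : RealTestFunction d) (ha : ∀ y, a y ≠ 0 → 1 ≤ ‖y‖ ∧ ‖y‖ ≤ 2) :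
    ∃ K, ∀ R, 1 ≤ R → |∫ x, F x * (a.osc α k R).eul d x| ≤ K * (R ^ d * (1 + R ^ (α - 1)) ^ 2) := by
  obtain ⟨C, hC0, hC⟩ := hF.exists_le
  obtain ⟨D, hD0, hD⟩ := a.exists_osc_bounds α k
  refine ⟨C * D * volume.real (Metric.closedBall (0 : Eucl d) 2), fun R hR => ?_⟩
  have hR0 : 0 < R := by linarith
  set l := 1 + R ^ (α - 1)
  have hl : 1 ≤ l := le_add_of_nonneg_right (Real.rpow_nonneg hR0.le _)
  refine (abs_integral_annulus_le (R := R) (M := C * D * l ^ 2) hR0 (by positivity)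
    (fun x hx => mem_of_eul_ne_zero (isClosed_annulus R (R * 2)) (norm_mem_annulus_of_osc_ne_zero hR0 ha)
      (right_ne_zero_of_mul hx)) ?_).trans (le_of_eq (by ring))
  filter_upwards [hC] with x hx hRx
  rw [abs_mul]
  calc |F x| * |(a.osc α k R).eul d x| ≤ (C * R⁻¹) * (D * (R * l)) := by
        refine mul_le_mul (hx.trans ?_) (hD R hR x).2.1 (abs_nonneg _) (by positivity)
        exact mul_le_mul_of_nonneg_left (bracket_rpow_neg_le hs hR0 hRx) hC0
    _ = C * D * l := by field_simp
    _ ≤ C * D * l ^ 2 := by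
        gcongr
        exact le_self_pow₀ hl (by norm_num)

/-- A derivative `v·∇F` of a short-range potential is bounded, as a form, on the oscillating test
functions: the derivative is moved to the test function at the price of a second derivative. -/
theorem exists_short_range_deriv_bound {ρ : ℝ} (hρ : 0 ≤ ρ) {v : Eucl d → Eucl d}
    (hv : ∃ C : ℝ, ∀ x, ‖fderiv ℝ v x‖ ≤ C) (hvg : ∃ C : ℝ, ∀ x, ‖v x‖ ≤ C * bracket x ^ ρ)
    {F U : Eucl d → ℝ} (hF : WeightedBounded (1 + ρ) F) (hU : IsDistribDirDeriv v F U)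
    (α k : ℝ) (a : RealTestFunction d) (ha : ∀ y, a y ≠ 0 → 1 ≤ ‖y‖ ∧ ‖y‖ ≤ 2) :
    ∃ K, ∀ R, 1 ≤ R → |∫ x, U x * (a.osc α k R).eul d x| ≤ K * (R ^ d * (1 + R ^ (α - 1)) ^ 2) := by
  obtain ⟨C, hC0, hC⟩ := hF.exists_le
  obtain ⟨D, hD0, hD⟩ := a.exists_osc_bounds α k
  obtain ⟨A, hA⟩ := hv
  obtain ⟨B, hB⟩ := hvg
  have hA0 : 0 ≤ A := (norm_nonneg _).trans (hA 0)
  have hb : ∀ x : Eucl d, 0 < bracket x := fun x => by linarith [one_le_bracket x]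
  have hB0 : 0 ≤ B := by
    have h := (norm_nonneg _).trans (hB 0)
    exact nonneg_of_mul_nonneg_left h (Real.rpow_pos_of_pos (hb 0) _)
  refine ⟨C * (B + d * A) * D * volume.real (Metric.closedBall (0 : Eucl d) 2), fun R hR => ?_⟩
  have hR0 : 0 < R := by linarith
  set l := 1 + R ^ (α - 1)
  have hl : 1 ≤ l := le_add_of_nonneg_right (Real.rpow_nonneg hR0.le _)
  set Ψ := (a.osc α k R).eul d
  have hK := isClosed_annulus (d := d) R (R * 2)
  have hΨ : ∀ x, Ψ x ≠ 0 → R ≤ ‖x‖ ∧ ‖x‖ ≤ R * 2 := fun x hx =>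
    mem_of_eul_ne_zero hK (norm_mem_annulus_of_osc_ne_zero hR0 ha) hx
  rw [hU Ψ Ψ.smooth Ψ.compact, abs_neg]
  refine (abs_integral_annulus_le (R := R) (M := C * (B + d * A) * D * l ^ 2) hR0 (by positivity)
    (fun x hx => ?_) ?_).trans (le_of_eq (by ring))
  · by_cases h1 : Ψ x = 0
    · refine mem_of_fderiv_ne_zero hK hΨ fun h2 => hx ?_
      rw [h1, h2]
      simp
    · exact hΨ x h1
  · filter_upwards [hC] with x hx hRx
    have h1 : |fderiv ℝ (Ψ : Eucl d → ℝ) x (v x)| ≤ D * (R * l ^ 2) * (B * bracket x ^ ρ) :=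
      ((fderiv ℝ (Ψ : Eucl d → ℝ) x).le_opNorm _).trans
        (mul_le_mul (hD R hR x).2.2.1 (hB x) (norm_nonneg _) (by positivity))
    have h2 : |divergence v x * Ψ x| ≤ d * A * (D * (R * l ^ 2)) := by
      rw [abs_mul]
      refine mul_le_mul (abs_divergence_le (hA x)) ((hD R hR x).2.1.trans ?_) (abs_nonneg _)
        (by positivity)
      gcongr
      exact le_self_pow₀ hl (by norm_num)
    have h3 : 1 ≤ bracket x ^ ρ := Real.one_le_rpow (one_le_bracket x) hρ
    have h4 : d * A * (D * (R * l ^ 2)) ≤ d * A * (D * (R * l ^ 2)) * bracket x ^ ρ :=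
      le_mul_of_one_le_right (by positivity) h3
    have h5 : bracket x ^ (-(1 + ρ)) * bracket x ^ ρ ≤ R⁻¹ := by
      rw [← Real.rpow_add (hb x), show -(1 + ρ) + ρ = -1 by ring]
      exact bracket_rpow_neg_le le_rfl hR0 hRx
    rw [abs_mul]
    calc |F x| * |fderiv ℝ (Ψ : Eucl d → ℝ) x (v x) + divergence v x * Ψ x|
        ≤ (C * bracket x ^ (-(1 + ρ))) * ((B + d * A) * D * (R * l ^ 2) * bracket x ^ ρ) := by
          refine mul_le_mul hx ((abs_add_le _ _).trans ?_) (abs_nonneg _)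
            (mul_nonneg hC0 (Real.rpow_nonneg (hb x).le _))
          linarith
      _ = C * ((B + d * A) * D * (R * l ^ 2)) * (bracket x ^ (-(1 + ρ)) * bracket x ^ ρ) := by ring
      _ ≤ C * ((B + d * A) * D * (R * l ^ 2)) * R⁻¹ := by gcongr
      _ = _ := by field_simp

/-- A long-range potential `F` is bounded, as a form, on the oscillating test functions, because
`U = x·∇F` is bounded. -/
theorem exists_long_range_bound {s : ℝ} (hs : 0 ≤ s) {F U : Eucl d → ℝ}
    (hU : IsDistribDirDeriv (fun x => x) F U) (hUb : WeightedBounded s U)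
    (α k : ℝ) (a : RealTestFunction d) (ha : ∀ y, a y ≠ 0 → 1 ≤ ‖y‖ ∧ ‖y‖ ≤ 2) :
    ∃ K, ∀ R, 1 ≤ R → |∫ x, F x * (a.osc α k R).eul d x| ≤ K * (R ^ d * (1 + R ^ (α - 1)) ^ 2) := by
  obtain ⟨C, hC0, hC⟩ := hUb.exists_bound hs
  obtain ⟨D, hD0, hD⟩ := a.exists_osc_bounds α k
  refine ⟨C * D * volume.real (Metric.closedBall (0 : Eucl d) 2), fun R hR => ?_⟩
  have hR0 : 0 < R := by linarith
  set l := 1 + R ^ (α - 1)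
  have hl : 1 ≤ l := le_add_of_nonneg_right (Real.rpow_nonneg hR0.le _)
  set G := a.osc α k R
  have h1 : ∫ x, F x * G.eul d x = -∫ x, U x * G x := by
    rw [hU G G.smooth G.compact, neg_neg]
    refine integral_congr_ae (.of_forall fun x => ?_)
    simp only [eul_apply, divergence_id]
    ring
  rw [h1, abs_neg]
  refine (abs_integral_annulus_le (R := R) (M := C * D * l ^ 2) hR0 (by positivity)
    (fun x hx => norm_mem_annulus_of_osc_ne_zero hR0 ha x (right_ne_zero_of_mul hx)) ?_).trans
    (le_of_eq (by ring))
  filter_upwards [hC] with x hx _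
  rw [abs_mul]
  calc |U x| * |G x| ≤ C * D := mul_le_mul hx (hD R hR x).1 (abs_nonneg _) hC0
    _ ≤ _ := le_mul_of_one_le_right (by positivity) (one_le_pow₀ hl)

theorem abs_oscPotential_le {α β w k : ℝ} (hβ : 0 ≤ β) {κ : ℝ → ℝ}
    (hκ1 : ∀ t ∈ Set.Icc (-1 : ℝ) 1, κ t = 1) (hκ01 : ∀ t, 0 ≤ κ t ∧ κ t ≤ 1) (x : Eucl d) :
    |oscPotential w k α β κ x| ≤ |w| := by
  have hw := abs_nonneg w
  rcases le_or_gt ‖x‖ 1 with h | h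
  · rw [oscPotential, hκ1 ‖x‖ ⟨by linarith [norm_nonneg x], h⟩]
    simp [hw]
  · have h1 : |1 - κ ‖x‖| ≤ 1 := abs_le.mpr ⟨by linarith [(hκ01 ‖x‖).2], by linarith [(hκ01 ‖x‖).1]⟩
    have h2 : |‖x‖ ^ (-β)| ≤ 1 := by
      rw [abs_of_nonneg (Real.rpow_nonneg (norm_nonneg _) _)]
      exact Real.rpow_le_one_of_one_le_of_nonpos h.le (by linarith)
    have h3 := Real.abs_sin_le_one (k * ‖x‖ ^ α)
    rw [oscPotential, abs_mul, abs_mul, abs_mul, mul_assoc, mul_assoc]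
    exact mul_le_of_le_one_right hw
      (mul_le_one₀ h1 (by positivity) (mul_le_one₀ h2 (abs_nonneg _) h3))

theorem measurable_oscPotential {α β w k : ℝ} {κ : ℝ → ℝ} (hκ : Continuous κ) :
    Measurable (oscPotential (d := d) w k α β κ) := by
  have := hκ.measurable
  unfold oscPotential
  fun_prop

end Range

end OscSchrodinger

end

open OscSchrodinger in
theorem proposition3p2 (d : ℕ) (hd : 0 < d)
    -- parameters
    (α β w k : ℝ) (hα : 0 < α) (hβ : 0 < β) (hw : w ≠ 0) (hk : k ≠ 0)
    (hαβ : |α - 1| + β < 1)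
    (ρsr ρlr ρlr' : ℝ) (hρsr : ρsr ∈ Set.Ioc (0 : ℝ) 1) (hρlr : ρlr ∈ Set.Ioc (0 : ℝ) 1)
    (hρlr' : ρlr' ∈ Set.Ioc (0 : ℝ) 1)
    -- the cut-off function
    (κ : ℝ → ℝ) (hκ : ContDiff ℝ ∞ κ) (hκc : HasCompactSupport κ)
    (hκ1 : ∀ t ∈ Set.Icc (-1 : ℝ) 1, κ t = 1) (hκ01 : ∀ t, 0 ≤ κ t ∧ κ t ≤ 1)
    -- the vector field
    (v : Eucl d → Eucl d) (hv : ContDiff ℝ 1 v) (hv' : ∃ C : ℝ, ∀ x, ‖fderiv ℝ v x‖ ≤ C)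
    (hvg : ∃ C : ℝ, ∀ x, ‖v x‖ ≤ C * bracket x ^ ρsr)
    -- the short range potential `Vsr`, and the function `Usr = v·∇Vtsr` with `Vtsr` short range
    (Vsr Vtsr Usr : Eucl d → ℝ) (hVsr : WeightedBounded (1 + ρsr) Vsr)
    (hVtsr : WeightedBounded (1 + ρsr) Vtsr) (hUsr : IsDistribDirDeriv v Vtsr Usr)
    (hUsrb : WeightedBounded ρsr Usr)
    -- the long range potential `Vlr`, and the function `Ulr = x·∇Vlr`
    (Vlr Ulr : Eucl d → ℝ) (hVlr : WeightedBounded ρlr Vlr)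
    (hUlr : IsDistribDirDeriv (fun x => x) Vlr Ulr) (hUlrb : WeightedBounded ρlr' Ulr)
    -- the compactly supported, possibly singular potential
    (Vc : Eucl d → ℝ) (hVcm : AEMeasurable Vc MeasureTheory.volume) (hVcs : HasCompactSupport Vc)
    (hVc : IsRelativelyCompact (mulOp Vc) (freeHamiltonian d)) :
    -- `H` is not of class `C¹(A)`
    ¬ IsC1 (dilation d)
        (schrodinger fun x => Vsr x + Usr x + Vlr x + Vc x + oscPotential w k α β κ x) ∧
    -- the form `[W(Q), A]` is not bounded from `H²` to `H⁻²`
    ¬ CommutatorBoundedOnSobolevTwo (mulOp (oscPotential (d := d) w k α β κ)) := by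
  obtain ⟨φ, hφ, hφpos⟩ := RealTestFunction.exists_annulus_bump hd
  set a := φ.mul φ
  have ha : ∀ y, a y ≠ 0 → 1 ≤ ‖y‖ ∧ ‖y‖ ≤ 2 := fun y hy => hφ y (left_ne_zero_of_mul hy)
  have ha0 : ∀ y, 0 ≤ a y := fun y => mul_self_nonneg _
  obtain ⟨S, -, hS⟩ := φ.exists_size_mul_size_le α k
  set W : Eucl d → ℝ := oscPotential w k α β κ
  have hWm : AEMeasurable W := (measurable_oscPotential hκ.continuous).aemeasurable
  have hWb : ∀ᵐ x, |W x| ≤ |w| := .of_forall (abs_oscPotential_le hβ.le hκ1 hκ01)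
  have hfg : ∀ R, 1 ≤ R → ((φ.scale R).mul (φ.osc α k R)) = a.osc α k R := fun R hR =>
    RealTestFunction.scale_mul_osc (by linarith) α k φ
  have hsize : ∀ K R : ℝ, 1 ≤ R → K * (φ.scale R).size * (φ.osc α k R).size ≤
      |K| * S * (R ^ d * (1 + R ^ (α - 1)) ^ 2) := by
    intro K R hR
    have h1 := (φ.scale R).size_nonneg
    have h2 := (φ.osc α k R).size_nonneg
    calc K * (φ.scale R).size * (φ.osc α k R).size
        ≤ |K| * ((φ.scale R).size * (φ.osc α k R).size) := by
          rw [mul_assoc]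
          exact mul_le_mul_of_nonneg_right (le_abs_self K) (by positivity)
      _ ≤ |K| * (S * (R ^ d * (1 + R ^ (α - 1)) ^ 2)) :=
          mul_le_mul_of_nonneg_left (hS R hR) (abs_nonneg K)
      _ = _ := by ring
  constructor
  · intro hC1
    -- near infinity the potential is bounded, since `Vc` vanishes there
    obtain ⟨r, hr⟩ := hVcs.isCompact.isBounded.subset_closedBall 0
    have hVc0 : ∀ x, r + 1 ≤ ‖x‖ → Vc x = 0 := by
      intro x hx
      by_contra h
      have := mem_closedBall_zero_iff.mp (hr (subset_tsupport _ h))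
      linarith
    obtain ⟨C₁, -, hC₁⟩ := hVsr.exists_bound (by linarith [hρsr.1])
    obtain ⟨C₂, -, hC₂⟩ := hUsrb.exists_bound hρsr.1.le
    obtain ⟨C₃, -, hC₃⟩ := hVlr.exists_bound hρlr.1.le
    obtain ⟨K, hK⟩ := exists_virial_bound
      (W := fun x => Vsr x + Usr x + Vlr x + Vc x + W x)
      (V := fun x => Vsr x + Usr x + Vlr x + W x)
      (C₀ := C₁ + C₂ + C₃ + |w|) (r := r + 1)
      ((((hVsr.1.add hUsrb.1).add hVlr.1).add hVcm).add hWm)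
      (((hVsr.1.add hUsrb.1).add hVlr.1).add hWm)
      (by
        filter_upwards [hC₁, hC₂, hC₃, hWb] with x h1 h2 h3 h4
        have e1 := abs_add_le (Vsr x + Usr x + Vlr x) (W x)
        have e2 := abs_add_le (Vsr x + Usr x) (Vlr x)
        have e3 := abs_add_le (Vsr x) (Usr x)
        linarith)
      (fun x hx => by rw [hVc0 x hx, add_zero]) hC1
    obtain ⟨K₁, hK₁⟩ := hVsr.exists_short_range_bound (by linarith [hρsr.1]) α k a ha
    obtain ⟨K₂, hK₂⟩ := exists_short_range_deriv_bound hρsr.1.le hv' hvg hVtsr hUsr α k a ha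
    obtain ⟨K₃, hK₃⟩ := exists_long_range_bound hρlr'.1.le hUlr hUlrb α k a ha
    refine not_exists_resonance_bound hα hβ hw hk hαβ hκc a ha0 (fun y hy => (ha y hy).1) hφpos
      (K := |K| * S + K₁ + K₂ + K₃) (R₀ := max 1 (r + 1)) fun R hR => ?_
    have hR1 : 1 ≤ R := (le_max_left _ _).trans hR
    have hR0 : 0 < R := by linarith
    have hRr : r + 1 ≤ R := (le_max_right _ _).trans hR
    have h := hK (φ.scale R) (φ.osc α k R)
      (fun x hx => hRr.trans (by
        simpa using (RealTestFunction.norm_mem_of_scale_ne_zero hR0 hφ hx).1))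
      (fun x hx => hRr.trans (norm_mem_annulus_of_osc_ne_zero hR0 hφ x hx).1)
    rw [hfg R hR1] at h
    set Ψ := (a.osc α k R).eul d
    have hint : ∀ (F : Eucl d → ℝ) (C : ℝ), AEMeasurable F → (∀ᵐ x, |F x| ≤ C) →
        MeasureTheory.Integrable (fun x => F x * Ψ x) := fun F C hF hb =>
      Ψ.integrable.bdd_mul hF.aestronglyMeasurable hb
    have i1 := hint Vsr C₁ hVsr.1 hC₁
    have i2 := hint Usr C₂ hUsrb.1 hC₂
    have i3 := hint Vlr C₃ hVlr.1 hC₃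
    have i4 := hint W |w| hWm hWb
    have hsum : ∫ x, (Vsr x + Usr x + Vlr x + W x) * Ψ x =
        (∫ x, Vsr x * Ψ x) + (∫ x, Usr x * Ψ x) + (∫ x, Vlr x * Ψ x) + ∫ x, W x * Ψ x := by
      simp only [add_mul]
      have i12 := i1.add i2
      simp only [Pi.add_def] at i12
      have i123 := i12.add i3
      simp only [Pi.add_def] at i123
      rw [MeasureTheory.integral_add i123 i4, MeasureTheory.integral_add i12 i3,
        MeasureTheory.integral_add i1 i2]
    rw [hsum] at h
    have h0 := h.trans (hsize K R hR1)
    have h1 := hK₁ R hR1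
    have h2 := hK₂ R hR1
    have h3 := hK₃ R hR1
    rw [abs_le] at h0 h1 h2 h3 ⊢
    constructor <;> linarith [h0.1, h0.2, h1.1, h1.2, h2.1, h2.2, h3.1, h3.2]
  · intro hc
    obtain ⟨K, hK⟩ := hc.exists_virial_bound hWm hWb
    refine not_exists_resonance_bound hα hβ hw hk hαβ hκc a ha0 (fun y hy => (ha y hy).1) hφpos
      (K := |K| * S) (R₀ := 1) fun R hR => ?_
    have h := hK (φ.scale R) (φ.osc α k R)
    rw [hfg R hR] at h
    exact h.trans (hsize K R hR)
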